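/- All quantum systems are finite-dimensional. Let $\mathcal{N}_{AB\to C}$ be a quantum channel (a completely positive, trace-preserving linear map) with two senders $A$, $B$ and one receiver $C$, let $\theta_{RA}$ and $\gamma_{SB}$ be density operators, and set $\omega_{RSC}=\mathcal{N}_{AB\to C}(\theta_{RA}\otimes\gamma_{SB})$. Write $H(\rho)=-\operatorname{Tr}\rho\log_2\rho$, $H(X|Y)_\omega=H(XY)_\omega-H(Y)_\omega$ and $H_2(X)_\omega=-\log_2\operatorname{Tr}\{\omega_X^2\}$, where $\omega_X$ is the marginal of $\omega$ on $X$. An $(L,M,\varepsilon)$ entanglement-assisted code for a channel $\mathcal{N}_{AB\to C}$ consists of a state $\Phi_{RA'}$ shared by the receiver and the first sender, a state $\Psi_{SB'}$ shared by the receiver and the second sender, encoding channels $\mathcal{E}^l_{A'\to A}$ ($1\le l\le L$), $\mathcal{F}^m_{B'\to B}$ ($1\le m\le M$), and decoding measurement operators $\Lambda^{l,m}_{RSC}\ge 0$ with $\sum_{l,m}\Lambda^{l,m}\le I$ (the remaining outcome counts as an error), such that $$\frac1{LM}\sum_{l=1}^{L}\sum_{m=1}^{M}\operatorname{Tr}\{(I-\Lambda^{l,m})\,\mathcal{N}(\mathcal{E}^l(\Phi_{RA'})\otimes\mathcal{F}^m(\Psi_{SB'}))\}\le\varepsilon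 .$$ Such a code is a position-based code with resource states $\theta_{RA}$, $\gamma_{SB}$ and a quantum simultaneous decoder if the shared states are $\theta_{RA}^{\otimes L}=\theta_{R_1A_1}\otimes\cdots\otimes\theta_{R_LA_L}$ and $\gamma_{SB}^{\otimes M}$, the encoders $\mathcal{E}^l$, $\mathcal{F}^m$ send the $l$-th $A$ system and the $m$-th $B$ system (discarding the others), and for some test operator $0\le T_{RSC}\le I$ the decoder is the square-root measurement $$\Lambda^{l,m}=\Big(\sum_{l',m'}\Gamma^{l',m'}\Big)^{-1/2}\Gamma^{l,m}\Big(\sum_{l',m'}\Gamma^{l',m'}\Big)^{-1/2},\qquad \Gamma^{l,m}=T_{R_lS_mC},$$ where $T_{R_lS_mC}$ acts as the identity on all other $R$ and $S$ systems and the inverse is taken on the support. Theorem. Let $R_1,R_2\in\mathbb{R}$ satisfy $$R_1\le H_2(SC)_\omega-H(SC|R)_\omega,\qquad R_2\le H_2(RC)_\omega-H(RC|S)_\omega,\qquad R_1+R_2\le H_2(C)_\omega-H(C|RS)_\omega .$$ Then $(R_1,R_2)$ is achievable for entanglement-assisted classical communication over $\mathcal{N}$ with a quantum simultaneous decoder: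 for all $\varepsilon\in(0,1)$ and $\delta>0$ and all sufficiently large $n$ there is an $(\lceil 2^{n(R_1-\delta)}\rceil,\lceil 2^{n(R_2-\delta)}\rceil,\varepsilon)$ entanglement-assisted code for $\mathcal{N}^{\otimes n}$ that is a position-based code with resource states $\theta_{RA}^{\otimes n}$, $\gamma_{SB}^{\otimes n}$ and a quantum simultaneous decoder. -/

import Mathlib

open scoped Kronecker ComplexOrder
open Filter

namespace EAMAC

/-! Quantum systems are finite index types; operators on a system `X` are matrices over `X`.
A composite system is a product type, and `n` copies of `X` form the system `Fin n → X`. -/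

/-- Density operators. -/
def IsState {X : Type*} [Fintype X] (ρ : Matrix X X ℂ) : Prop :=
  ρ.PosSemidef ∧ ρ.trace = 1

/-- Measurement (test) operators, `0 ≤ T ≤ I`. -/
def IsTest {X : Type*} [Fintype X] [DecidableEq X] (T : Matrix X X ℂ) : Prop :=
  T.PosSemidef ∧ (1 - T).PosSemidef

/-- `id_K ⊗ N`: the map `N` applied to the second factor of a composite system. -/
def ampliate (K : Type*) {X Y : Type*} (N : Matrix X X ℂ →ₗ[ℂ] Matrix Y Y ℂ)
    (Z : Matrix (K × X) (K × X) ℂ) : Matrix (K × Y) (K × Y) ℂ :=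
  Matrix.of fun p q => N (Matrix.of fun i j => Z (p.1, i) (q.1, j)) p.2 q.2

/-- Quantum channels: completely positive and trace preserving linear maps. -/
def IsChannel {X Y : Type*} [Fintype X] [Fintype Y]
    (N : Matrix X X ℂ →ₗ[ℂ] Matrix Y Y ℂ) : Prop :=
  (∀ (k : ℕ) (Z : Matrix (Fin k × X) (Fin k × X) ℂ),
      Z.PosSemidef → (ampliate (Fin k) N Z).PosSemidef) ∧
    ∀ Z : Matrix X X ℂ, (N Z).trace = Z.trace

/-- The output `N_{AB→C}(σ_RA ⊗ τ_SB)`, an operator on `RSC`. -/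
def macOut {A B C R S : Type*} (N : Matrix (A × B) (A × B) ℂ →ₗ[ℂ] Matrix C C ℂ)
    (σ : Matrix (R × A) (R × A) ℂ) (τ : Matrix (S × B) (S × B) ℂ) :
    Matrix ((R × S) × C) ((R × S) × C) ℂ :=
  ampliate (R × S) N
    ((σ ⊗ₖ τ).submatrix (Equiv.prodProdProdComm R S A B) (Equiv.prodProdProdComm R S A B))

/-- The `n`-fold tensor power `N^{⊗n}` of a map `N_{AB→C}`, from `AⁿBⁿ` to `Cⁿ`; it is given by
its action on matrix units, `N^{⊗n}(⊗ₜ |iₜ⟩⟨jₜ|) = ⊗ₜ N(|iₜ⟩⟨jₜ|)`. -/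
def macPow {A B C : Type*} [Fintype A] [Fintype B] [DecidableEq A] [DecidableEq B]
    (N : Matrix (A × B) (A × B) ℂ →ₗ[ℂ] Matrix C C ℂ) (n : ℕ) :
    Matrix ((Fin n → A) × (Fin n → B)) ((Fin n → A) × (Fin n → B)) ℂ →ₗ[ℂ]
      Matrix (Fin n → C) (Fin n → C) ℂ where
  toFun Z := Matrix.of fun c c' => ∑ i, ∑ j,
    Z i j * ∏ t, N (Matrix.single (i.1 t, i.2 t) (j.1 t, j.2 t) 1) (c t) (c' t)
  map_add' Z W := by
    ext c c'
    simp [add_mul, Finset.sum_add_distrib]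
  map_smul' a Z := by
    ext c c'
    simp [Finset.mul_sum, mul_assoc]

/-- Independent copies `θ_RA^{⊗ι}` of a bipartite operator, with all the `R` systems collected in
the first factor and all the `A` systems in the second. -/
def copies {R A : Type*} (ι : Type*) [Fintype ι] (θ : Matrix (R × A) (R × A) ℂ) :
    Matrix ((ι → R) × (ι → A)) ((ι → R) × (ι → A)) ℂ :=
  Matrix.of fun x y => ∏ i, θ (x.1 i, x.2 i) (y.1 i, y.2 i)

/-! ### Entropies (in bits) -/

/-- Von Neumann entropy `H(ρ) = -Tr ρ log₂ ρ`. -/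
noncomputable def entropy {X : Type*} [Fintype X] [DecidableEq X] (ρ : Matrix X X ℂ) : ℝ :=
  (cfc (fun x : ℝ => -(x * Real.logb 2 x)) ρ).trace.re

/-- Rényi entropy of order two, `H₂(ρ) = -log₂ Tr ρ²`. -/
noncomputable def entropyTwo {X : Type*} [Fintype X] (ρ : Matrix X X ℂ) : ℝ :=
  -Real.logb 2 (ρ * ρ).trace.re

section Marginals

variable {R S C : Type*}

/-- The marginal `ω_SC` of `ω_RSC`. -/
def margSC [Fintype R] (ω : Matrix ((R × S) × C) ((R × S) × C) ℂ) : Matrix (S × C) (S × C) ℂ :=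
  Matrix.of fun x y => ∑ r, ω ((r, x.1), x.2) ((r, y.1), y.2)

/-- The marginal `ω_RC` of `ω_RSC`. -/
def margRC [Fintype S] (ω : Matrix ((R × S) × C) ((R × S) × C) ℂ) : Matrix (R × C) (R × C) ℂ :=
  Matrix.of fun x y => ∑ s, ω ((x.1, s), x.2) ((y.1, s), y.2)

/-- The marginal `ω_RS` of `ω_RSC`. -/
def margRS [Fintype C] (ω : Matrix ((R × S) × C) ((R × S) × C) ℂ) : Matrix (R × S) (R × S) ℂ :=
  Matrix.of fun x y => ∑ c, ω (x, c) (y, c)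

/-- The marginal `ω_R` of `ω_RSC`. -/
def margR [Fintype S] [Fintype C] (ω : Matrix ((R × S) × C) ((R × S) × C) ℂ) : Matrix R R ℂ :=
  Matrix.of fun r r' => ∑ s, ∑ c, ω ((r, s), c) ((r', s), c)

/-- The marginal `ω_S` of `ω_RSC`. -/
def margS [Fintype R] [Fintype C] (ω : Matrix ((R × S) × C) ((R × S) × C) ℂ) : Matrix S S ℂ :=
  Matrix.of fun s s' => ∑ r, ∑ c, ω ((r, s), c) ((r, s'), c)

/-- The marginal `ω_C` of `ω_RSC`. -/
def margC [Fintype R] [Fintype S] (ω : Matrix ((R × S) × C) ((R × S) × C) ℂ) : Matrix C C ℂ :=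
  Matrix.of fun c c' => ∑ r, ∑ s, ω ((r, s), c) ((r, s), c')

variable [Fintype R] [Fintype S] [Fintype C] [DecidableEq R] [DecidableEq S] [DecidableEq C]

/-- Conditional entropy `H(SC|R) = H(RSC) - H(R)`. -/
noncomputable def condSCgivenR (ω : Matrix ((R × S) × C) ((R × S) × C) ℂ) : ℝ :=
  entropy ω - entropy (margR ω)

/-- Conditional entropy `H(RC|S) = H(RSC) - H(S)`. -/
noncomputable def condRCgivenS (ω : Matrix ((R × S) × C) ((R × S) × C) ℂ) : ℝ :=
  entropy ω - entropy (margS ω)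

/-- Conditional entropy `H(C|RS) = H(RSC) - H(RS)`. -/
noncomputable def condCgivenRS (ω : Matrix ((R × S) × C) ((R × S) × C) ℂ) : ℝ :=
  entropy ω - entropy (margRS ω)

/-- `Ĩ(R;CS) = H₂(SC) - H(SC|R)`. -/
noncomputable def infoR_CS (ω : Matrix ((R × S) × C) ((R × S) × C) ℂ) : ℝ :=
  entropyTwo (margSC ω) - condSCgivenR ω

/-- `Ĩ(S;CR) = H₂(RC) - H(RC|S)`. -/
noncomputable def infoS_CR (ω : Matrix ((R × S) × C) ((R × S) × C) ℂ) : ℝ :=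
  entropyTwo (margRC ω) - condRCgivenS ω

/-- `Ĩ(RS;C) = H₂(C) - H(C|RS)`. -/
noncomputable def infoRS_C (ω : Matrix ((R × S) × C) ((R × S) × C) ℂ) : ℝ :=
  entropyTwo (margC ω) - condCgivenRS ω

end Marginals

/-! ### Entanglement-assisted codes for a multiple-access channel -/

/-- An entanglement-assisted code with `L` and `M` messages for `N_{AB→C}`: Charlie and Alice share
`Φ_{RA'}`, Charlie and Bob share `Ψ_{SB'}`, and Charlie measures `RSC` with the operators
`povm l m` (the complement of their sum is the outcome "no message pair", always an error). -/
structure Code {A B C : Type*} [Fintype A] [Fintype B] [Fintype C] [DecidableEq C]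
    (N : Matrix (A × B) (A × B) ℂ →ₗ[ℂ] Matrix C C ℂ) (R A' S B' : Type*)
    [Fintype R] [Fintype A'] [Fintype S] [Fintype B'] [DecidableEq R] [DecidableEq S]
    (L M : ℕ) where
  /-- The state shared by Charlie and Alice. -/
  Φ : Matrix (R × A') (R × A') ℂ
  /-- The state shared by Charlie and Bob. -/
  Ψ : Matrix (S × B') (S × B') ℂ
  /-- Alice's encoders. -/
  encA : Fin L → (Matrix A' A' ℂ →ₗ[ℂ] Matrix A A ℂ)
  /-- Bob's encoders. -/
  encB : Fin M → (Matrix B' B' ℂ →ₗ[ℂ] Matrix B B ℂ)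
  /-- Charlie's decoding measurement. -/
  povm : Fin L → Fin M → Matrix ((R × S) × C) ((R × S) × C) ℂ
  isState_Φ : IsState Φ
  isState_Ψ : IsState Ψ
  isChannel_encA : ∀ l, IsChannel (encA l)
  isChannel_encB : ∀ m, IsChannel (encB m)
  povm_nonneg : ∀ l m, (povm l m).PosSemidef
  povm_sum_le : (1 - ∑ l, ∑ m, povm l m).PosSemidef

section Code

variable {A B C : Type*} [Fintype A] [Fintype B] [Fintype C] [DecidableEq C]
  {N : Matrix (A × B) (A × B) ℂ →ₗ[ℂ] Matrix C C ℂ} {R A' S B' : Type*}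
  [Fintype R] [Fintype A'] [Fintype S] [Fintype B'] [DecidableEq R] [DecidableEq S] {L M : ℕ}

/-- `p_e(l,m) = Tr{(I - Λ^{l,m}) N(E^l(Φ_{RA'}) ⊗ F^m(Ψ_{SB'}))}`. -/
noncomputable def Code.errorProb (c : Code N R A' S B' L M) (l : Fin L) (m : Fin M) : ℝ :=
  ((1 - c.povm l m) *
    macOut N (ampliate R (c.encA l) c.Φ) (ampliate S (c.encB m) c.Ψ)).trace.re

/-- Average error probability. -/
noncomputable def Code.avgError (c : Code N R A' S B' L M) : ℝ :=
  1 / ((L : ℝ) * (M : ℝ)) * ∑ l, ∑ m, c.errorProb l m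

end Code

/-! ### Position-based coding and the simultaneous decoder -/

/-- Keep the `l`-th of several copies of `X` and discard (trace out) the others. -/
def keep {ι X : Type*} [Fintype ι] [DecidableEq ι] [Fintype X] [DecidableEq X] (l : ι) :
    Matrix (ι → X) (ι → X) ℂ →ₗ[ℂ] Matrix X X ℂ where
  toFun Z := Matrix.of fun a a' => ∑ x, if x l = a then Z x (Function.update x l a') else 0
  map_add' Z W := by
    ext a a'
    simp only [Matrix.of_apply, Matrix.add_apply, ← Finset.sum_add_distrib]
    exact Finset.sum_congr rfl fun x _ => by split_ifs <;> simp
  map_smul' k Z := by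
    ext a a'
    simp [Finset.mul_sum]

/-- `Γ^{l,m} = T_{R_l S_m C}`: the operator `T_{RSC}` acting on the `l`-th copy of `R`, the `m`-th
copy of `S` and on `C`, tensored with the identity on all other systems. -/
def checkPair {R S C : Type*} [DecidableEq R] [DecidableEq S] {L M : ℕ}
    (T : Matrix ((R × S) × C) ((R × S) × C) ℂ) (l : Fin L) (m : Fin M) :
    Matrix (((Fin L → R) × (Fin M → S)) × C) (((Fin L → R) × (Fin M → S)) × C) ℂ :=
  Matrix.of fun x y =>
    if (∀ l', l' ≠ l → x.1.1 l' = y.1.1 l') ∧ (∀ m', m' ≠ m → x.1.2 m' = y.1.2 m') then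
      T ((x.1.1 l, x.1.2 m), x.2) ((y.1.1 l, y.1.2 m), y.2)
    else 0

/-- `X^{-1/2}` for positive semidefinite `X`, with the inverse taken on the support of `X`
(in `ℝ`, `0⁻¹ = 0`). -/
noncomputable def invSqrt {X : Type*} [Fintype X] [DecidableEq X] (Z : Matrix X X ℂ) :
    Matrix X X ℂ :=
  cfc (fun x : ℝ => (Real.sqrt x)⁻¹) Z

/-- The square-root measurement
`(∑ Γ^{l',m'})^{-1/2} Γ^{l,m} (∑ Γ^{l',m'})^{-1/2}`. -/
noncomputable def squareRootMeas {X : Type*} [Fintype X] [DecidableEq X] {L M : ℕ}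
    (Γ : Fin L → Fin M → Matrix X X ℂ) (l : Fin L) (m : Fin M) : Matrix X X ℂ :=
  invSqrt (∑ l', ∑ m', Γ l' m') * Γ l m * invSqrt (∑ l', ∑ m', Γ l' m')

/-- `Λ` is a (position-based) quantum simultaneous decoder: the square-root measurement formed from
a single test operator `T_{RSC}` that checks for each message pair `(l,m)` on `R_l S_m C`. -/
def IsSimultaneousDecoder {R S C : Type*} [Fintype R] [Fintype S] [Fintype C]
    [DecidableEq R] [DecidableEq S] [DecidableEq C] {L M : ℕ}
    (Λ : Fin L → Fin M →
      Matrix (((Fin L → R) × (Fin M → S)) × C) (((Fin L → R) × (Fin M → S)) × C) ℂ) : Prop :=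
  ∃ T : Matrix ((R × S) × C) ((R × S) × C) ℂ, IsTest T ∧
    ∀ l m, Λ l m = squareRootMeas (fun l' m' => checkPair T l' m') l m

/-- The code is a position-based code with resource states `θ_RA` and `γ_SB` and a quantum
simultaneous decoder: Charlie shares `θ^{⊗L}` with Alice and `γ^{⊗M}` with Bob, message `l` (`m`) is
sent by feeding the `l`-th `A` system (`m`-th `B` system) into the channel. -/
def IsPositionBased {A B C : Type*} [Fintype A] [Fintype B] [Fintype C]
    [DecidableEq A] [DecidableEq B] [DecidableEq C]
    {N : Matrix (A × B) (A × B) ℂ →ₗ[ℂ] Matrix C C ℂ} {R S : Type*}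
    [Fintype R] [Fintype S] [DecidableEq R] [DecidableEq S] {L M : ℕ}
    (θ : Matrix (R × A) (R × A) ℂ) (γ : Matrix (S × B) (S × B) ℂ)
    (c : Code N (Fin L → R) (Fin L → A) (Fin M → S) (Fin M → B) L M) : Prop :=
  c.Φ = copies (Fin L) θ ∧ c.Ψ = copies (Fin M) γ ∧
    (∀ l, c.encA l = keep l) ∧ (∀ m, c.encB m = keep m) ∧ IsSimultaneousDecoder c.povm

/-- The rate pair `(R₁, R₂)` is achievable for entanglement-assisted communication over `N` with
copies of `θ_RA` and `γ_SB` as shared states and a quantum simultaneous decoder: for all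
`ε ∈ (0,1)`, `δ > 0` and sufficiently large `n` there is such a
`(2^{n(R₁-δ)}, 2^{n(R₂-δ)}, ε)` code for `N^{⊗n}` (numbers of messages rounded up). -/
def AchievableBySimultaneousDecoding {A B C R S : Type*}
    [Fintype A] [Fintype B] [Fintype C] [Fintype R] [Fintype S]
    [DecidableEq A] [DecidableEq B] [DecidableEq C] [DecidableEq R] [DecidableEq S]
    (N : Matrix (A × B) (A × B) ℂ →ₗ[ℂ] Matrix C C ℂ)
    (θ : Matrix (R × A) (R × A) ℂ) (γ : Matrix (S × B) (S × B) ℂ) (R₁ R₂ : ℝ) : Prop :=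
  ∀ ε : ℝ, 0 < ε → ε < 1 → ∀ δ : ℝ, 0 < δ → ∀ᶠ n : ℕ in atTop,
    ∀ L M : ℕ, L = ⌈(2 : ℝ) ^ ((n : ℝ) * (R₁ - δ))⌉₊ → M = ⌈(2 : ℝ) ^ ((n : ℝ) * (R₂ - δ))⌉₊ →
      ∃ c : Code (macPow N n) (Fin L → Fin n → R) (Fin L → Fin n → A)
          (Fin M → Fin n → S) (Fin M → Fin n → B) L M,
        IsPositionBased (copies (Fin n) θ) (copies (Fin n) γ) c ∧ c.avgError ≤ ε

end EAMAC

set_option linter.unusedSectionVars false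

/-! The channel output on the correct registers is `ω^{⊗n}`, while a wrong message on one side
replaces it by `θ_R ⊗ ω_SC` or `γ_S ⊗ ω_RC`, and two wrong messages by `θ_R ⊗ γ_S ⊗ ω_C`, all to the
power `n`. So one binary test `T` is needed that accepts `ω^{⊗n}` and rejects all three alternatives
at once. Given such a test, the Hayashi–Nagaoka inequality bounds the error of the square-root
measurement by twice the missed detection plus four times the false acceptances, counted with `L -
1`, `M - 1` and `(L - 1)(M - 1)` wrong messages (`errorProb_positionCode_le`).

The test is `T = W Q W` with `W = P_R ⊗ P_S ⊗ I`. Here `Q` projects onto the eigenvectors of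
`ω^{⊗n}` with eigenvalue at least `2^{-nt}`, so `Q ≤ 2^{nt} ω^{⊗n}`. The projections `P_R`, `P_S`
keep the eigenvalues of the marginals of at most `2^{-nx}`, `2^{-ny}`, so `P_R θ^{⊗n} P_R ≤ 2^{-nx}
I`, and similarly for `P_S`. For `t > H(RSC)`, `x < H(R)`, `y < H(S)`, Chernoff bounds make all the
discarded weights exponentially small.

For the first alternative, write `η` for the `SC` marginal of `ω^{⊗n}`. Bounding `Q` by `2^{nt}
ω^{⊗n}` and then flattening `R` leaves `2^{n(t-x)} Tr[η P η P]` for a projection `P`, which is at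
most `2^{n(t-x)} Tr η²` (`trace_test_kronecker_le`). No projection has to be typical for `SC`, so
the three rejection requirements do not conflict; the price is that collision entropies `H₂` of the
marginals appear in place of von Neumann entropies. The third alternative also uses `H(RS) = H(R) +
H(S)`, valid because a trace-preserving channel leaves `RS` in a product state. -/

namespace EAMAC

/-! ### Operator inequalities -/

section OperatorInequalities

variable {X : Type*} [Fintype X] [DecidableEq X]

open scoped MatrixOrder in
theorem posSemidef_cfc {f : ℝ → ℝ} {A : Matrix X X ℂ} (h : ∀ x ∈ spectrum ℝ A, 0 ≤ f x) :
    (cfc f A).PosSemidef :=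
  Matrix.nonneg_iff_posSemidef.mp (cfc_nonneg h)

theorem isHermitian_cfc (f : ℝ → ℝ) (A : Matrix X X ℂ) : (cfc f A).IsHermitian :=
  cfc_predicate f A

open scoped MatrixOrder in
theorem spectrum_nonneg {A : Matrix X X ℂ} (hA : A.PosSemidef) {x : ℝ} (hx : x ∈ spectrum ℝ A) :
    0 ≤ x :=
  spectrum_nonneg_of_nonneg (Matrix.nonneg_iff_posSemidef.mpr hA) hx

theorem cfc_mul_matrix (f g : ℝ → ℝ) (A : Matrix X X ℂ) :
    cfc f A * cfc g A = cfc (fun x => f x * g x) A :=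
  (cfc_mul f g A (A.finite_real_spectrum.continuousOn f) (A.finite_real_spectrum.continuousOn g)).symm

theorem cfc_add_matrix (f g : ℝ → ℝ) (A : Matrix X X ℂ) :
    cfc f A + cfc g A = cfc (fun x => f x + g x) A :=
  (cfc_add A f g (A.finite_real_spectrum.continuousOn f) (A.finite_real_spectrum.continuousOn g)).symm

theorem cfc_sub_matrix (f g : ℝ → ℝ) (A : Matrix X X ℂ) :
    cfc f A - cfc g A = cfc (fun x => f x - g x) A :=
  (cfc_sub f g A (A.finite_real_spectrum.continuousOn f) (A.finite_real_spectrum.continuousOn g)).symm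

/-- The square root is operator monotone. -/
theorem posSemidef_sub_of_sq {A B : Matrix X X ℂ} (hA : A.PosSemidef) (hB : B.PosSemidef)
    (h : (B * B - A * A).PosSemidef) : (B - A).PosSemidef := by
  have hH : (B - A).IsHermitian := hB.1.sub hA.1
  refine hH.posSemidef_iff_eigenvalues_nonneg.mpr fun i => ?_
  -- Let `v` be a unit eigenvector of `B - A` with eigenvalue `μ < 0`. Since `B² - A² = B(B - A) +
  -- (B - A)A`, the hypothesis gives `μ(⟨v, Bv⟩ + ⟨v, Av⟩) ≥ 0`, which forces both nonnegative terms
  -- to vanish, although their difference is `μ`.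
  by_contra! hlt
  set v : X → ℂ := ⇑(hH.eigenvectorBasis i) with hv
  set μ := hH.eigenvalues i with hμ
  have hev : (B - A).mulVec v = (μ : ℂ) • v := by
    simpa using hH.mulVec_eigenvectorBasis i
  have h1 := h.dotProduct_mulVec_nonneg v
  have hA0 := hA.dotProduct_mulVec_nonneg v
  have hB0 := hB.dotProduct_mulVec_nonneg v
  have hleft : Matrix.vecMul (star v) (B - A) = (μ : ℂ) • star v := by
    have := congrArg star hev
    rw [Matrix.star_mulVec, hH.eq] at this
    simpa using this
  have key : B * B - A * A = B * (B - A) + (B - A) * A := by noncomm_ring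
  have e1 : star v ⬝ᵥ (B * B - A * A).mulVec v =
      (μ : ℂ) * (star v ⬝ᵥ B.mulVec v + star v ⬝ᵥ A.mulVec v) := by
    rw [key, Matrix.add_mulVec, dotProduct_add, ← Matrix.mulVec_mulVec, hev, ← Matrix.mulVec_mulVec,
      Matrix.dotProduct_mulVec (star v) (B - A), hleft, Matrix.mulVec_smul]
    simp only [dotProduct_smul, smul_dotProduct, smul_eq_mul]
    ring
  have e2 : star v ⬝ᵥ (B - A).mulVec v = (μ : ℂ) * (star v ⬝ᵥ v) := by
    rw [hev, dotProduct_smul, smul_eq_mul]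
  have e3 : star v ⬝ᵥ v = 1 := by
    have := hH.eigenvectorBasis.orthonormal.1 i
    have h2 : inner ℂ (hH.eigenvectorBasis i) (hH.eigenvectorBasis i) = (1 : ℂ) := by
      rw [inner_self_eq_norm_sq_to_K, this]; simp
    rw [EuclideanSpace.inner_eq_star_dotProduct, dotProduct_comm] at h2
    exact h2
  rw [e1] at h1
  rw [e3, Matrix.sub_mulVec, dotProduct_sub] at e2
  rw [Complex.le_def] at h1 hA0 hB0
  have e2r := congrArg Complex.re e2
  simp only [Complex.zero_re, Complex.mul_re, Complex.ofReal_re, Complex.ofReal_im, zero_mul,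
    sub_zero, Complex.add_re, Complex.sub_re, mul_one] at h1 hA0 hB0 e2r
  have hμ0 : μ < 0 := hlt
  have h10 := h1.1
  have hAr := hA0.1
  have hBr := hB0.1
  generalize (star v ⬝ᵥ B.mulVec v).re = b at *
  generalize (star v ⬝ᵥ A.mulVec v).re = a at *
  nlinarith

/-- The Hayashi–Nagaoka inequality. -/
theorem hayashi_nagaoka {S T : Matrix X X ℂ} (hS : IsTest S) (hT : T.PosSemidef) :
    ((2 : ℝ) • (1 - S) + (4 : ℝ) • T -
      (1 - invSqrt (S + T) * S * invSqrt (S + T))).PosSemidef := by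
  set W := S + T with hW
  have hWp : W.PosSemidef := hS.1.add hT
  have hWid : cfc (fun x : ℝ => x) W = W := cfc_id' ℝ W hWp.1
  have hone : cfc (fun _ : ℝ => (1 : ℝ)) W = 1 := cfc_const_one ℝ W hWp.1
  set Z := invSqrt W with hZ
  set Y := cfc Real.sqrt W with hY
  have hZh : Z.IsHermitian := isHermitian_cfc _ _
  have hYp : Y.PosSemidef := posSemidef_cfc fun x _ => Real.sqrt_nonneg x
  have hYY : Y * Y = W := by
    rw [hY, cfc_mul_matrix]
    conv_rhs => rw [← hWid]
    exact cfc_congr fun x hx => Real.mul_self_sqrt (spectrum_nonneg hWp hx)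
  have hSS : (S - S * S).PosSemidef := by
    have h1 := hS.2.conjTranspose_mul_mul_same S
    have h2 := hS.1.conjTranspose_mul_mul_same (1 - S)
    have : S - S * S = S.conjTranspose * (1 - S) * S + (1 - S).conjTranspose * S * (1 - S) := by
      rw [hS.1.1.eq, hS.2.1.eq]; noncomm_ring
    rw [this]; exact h1.add h2
  -- Since `S² ≤ S ≤ W = Y²`, operator monotonicity of the square root gives `S ≤ Y`.
  have hYS : (Y - S).PosSemidef := by
    refine posSemidef_sub_of_sq hS.1 hYp ?_
    have : Y * Y - S * S = (S - S * S) + T := by rw [hYY, hW]; abel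
    rw [this]; exact hSS.add hT
  have hD : ((Z - 1) * S * (Z - 1)).PosSemidef := by
    have := hS.1.conjTranspose_mul_mul_same (Z - 1)
    rwa [(hZh.sub Matrix.isHermitian_one).eq] at this
  have hE : ((2 - Z) * T * (2 - Z)).PosSemidef := by
    have := hT.conjTranspose_mul_mul_same (2 - Z)
    have h2 : (2 : Matrix X X ℂ).IsHermitian := by
      rw [← one_add_one_eq_two]; exact Matrix.isHermitian_one.add Matrix.isHermitian_one
    rwa [(h2.sub hZh).eq] at this
  -- As a function of `W` this is the projection onto its kernel: the scalar function vanishes for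
  -- `x > 0` and equals `1` at `x = 0`, where `f 0 = 0`.
  have hF : ((2 : ℝ) • (1 : Matrix X X ℂ) + (2 : ℝ) • W - (4 : ℝ) • Y
      - (1 - Z * W * Z + (2 : ℝ) • ((Z - 1) * W * (Z - 1)))).PosSemidef := by
    set f : ℝ → ℝ := fun x => (√x)⁻¹ with hf
    have hZW : Z * W * Z = cfc (fun x => f x * x * f x) W := by
      have : Z = cfc f W := rfl
      rw [this]
      nth_rw 2 [← hWid]
      rw [cfc_mul_matrix, cfc_mul_matrix]
    have hZ1 : (Z - 1) * W * (Z - 1) = cfc (fun x => (f x - 1) * x * (f x - 1)) W := by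
      have : Z - 1 = cfc (fun x => f x - 1) W := by rw [← cfc_sub_matrix, hone]; rfl
      rw [this]
      nth_rw 2 [← hWid]
      rw [cfc_mul_matrix, cfc_mul_matrix]
    have hY1 : 1 + W - Y - Y = cfc (fun x => 1 + x - √x - √x) W := by
      rw [← cfc_sub_matrix, ← cfc_sub_matrix, ← cfc_add_matrix, hone, hWid]
    have heq : (2 : ℝ) • (1 : Matrix X X ℂ) + (2 : ℝ) • W - (4 : ℝ) • Y
        - (1 - Z * W * Z + (2 : ℝ) • ((Z - 1) * W * (Z - 1))) =
        (1 + W - Y - Y - (Z - 1) * W * (Z - 1)) + (1 + W - Y - Y - (Z - 1) * W * (Z - 1))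
          - (1 - Z * W * Z) := by
      module
    rw [heq, hY1, hZ1, hZW, ← hone, cfc_sub_matrix, cfc_sub_matrix, cfc_add_matrix, cfc_sub_matrix]
    refine posSemidef_cfc fun x hx => ?_
    rcases (spectrum_nonneg hWp hx).eq_or_lt with rfl | hpos
    · simp
    · have h1 : f x * x * f x = 1 := by
        have h2 := Real.mul_self_sqrt hpos.le
        have h3 := (Real.sqrt_pos.mpr hpos).ne'
        simp only [hf]
        field_simp
        nlinarith
      have h2 : f x * x = √x := by
        have h2 := Real.mul_self_sqrt hpos.le
        have h3 := (Real.sqrt_pos.mpr hpos).ne'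
        simp only [hf]
        field_simp
        nlinarith
      have h3 : (f x - 1) * x * (f x - 1) = f x * x * f x - f x * x - f x * x + x := by ring
      rw [h3, h1, h2]
      linarith
  -- The claimed difference is exactly this sum of four positive operators: the two sandwiches
  -- produce the cross terms `ZW` and `WZ`, and `hF` cancels them.
  have hsum := ((hF.add (hYS.smul (show (0 : ℝ) ≤ 4 by norm_num))).add hE).add
    (hD.smul (show (0 : ℝ) ≤ 2 by norm_num))
  convert hsum using 1
  have h2 : ∀ M : Matrix X X ℂ, (2 : ℝ) • M = M + M := fun M => two_smul ℝ M
  have h4 : ∀ M : Matrix X X ℂ, (4 : ℝ) • M = M + M + (M + M) := fun M => by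
    rw [← h2, ← h2, smul_smul]; norm_num
  simp only [h2, h4, hW]
  noncomm_ring

/-- The sandwich is the support projection of `W`, equal to `1` on positive eigenvalues and `0` on
the kernel. This makes the square-root measurement subnormalised. -/
theorem invSqrt_mul_self_mul_invSqrt_le {W : Matrix X X ℂ} (hW : W.PosSemidef) :
    (1 - invSqrt W * W * invSqrt W).PosSemidef := by
  have hWid : cfc (fun x : ℝ => x) W = W := cfc_id' ℝ W hW.1
  have hone : cfc (fun _ : ℝ => (1 : ℝ)) W = 1 := cfc_const_one ℝ W hW.1
  have : invSqrt W * W * invSqrt W = cfc (fun x : ℝ => (√x)⁻¹ * x * (√x)⁻¹) W := by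
    rw [invSqrt]
    nth_rw 2 [← hWid]
    rw [cfc_mul_matrix, cfc_mul_matrix]
  rw [this, ← hone, cfc_sub_matrix]
  refine posSemidef_cfc fun x hx => ?_
  rcases (spectrum_nonneg hW hx).eq_or_lt with rfl | hpos
  · simp
  · have h2 := Real.mul_self_sqrt hpos.le
    have h3 := (Real.sqrt_pos.mpr hpos).ne'
    have : (√x)⁻¹ * x * (√x)⁻¹ = 1 := by
      field_simp
      nlinarith
    rw [this, sub_self]

open scoped MatrixOrder Matrix.Norms.L2Operator in
/-- The Hilbert–Schmidt inner product of positive semidefinite matrices is nonnegative. -/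
theorem trace_mul_re_nonneg {X : Type*} [Fintype X] {A B : Matrix X X ℂ} (hA : A.PosSemidef)
    (hB : B.PosSemidef) : 0 ≤ (A * B).trace.re := by
  classical
  obtain ⟨C, rfl⟩ := CStarAlgebra.nonneg_iff_eq_star_mul_self.mp hA.nonneg
  rw [Matrix.star_eq_conjTranspose, Matrix.mul_assoc, Matrix.trace_mul_comm]
  exact (Complex.le_def.mp (hB.mul_mul_conjTranspose_same C).trace_nonneg).1

theorem trace_mul_re_le {X : Type*} [Fintype X] {A A' B : Matrix X X ℂ} (hA : (A' - A).PosSemidef)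
    (hB : B.PosSemidef) : (A * B).trace.re ≤ (A' * B).trace.re := by
  have := trace_mul_re_nonneg hA hB
  rw [Matrix.sub_mul, Matrix.trace_sub, Complex.sub_re] at this
  linarith

/-- Finite entrywise products of positive semidefinite matrices are positive semidefinite. -/
theorem posSemidef_prod {ι Y : Type*} [Fintype Y] (s : Finset ι) {M : ι → Matrix Y Y ℂ}
    (hM : ∀ i ∈ s, (M i).PosSemidef) :
    (Matrix.of fun x y => ∏ i ∈ s, M i x y).PosSemidef := by
  classical
  induction s using Finset.induction_on with
  | empty =>
    have := Matrix.posSemidef_vecMulVec_self_star (fun _ : Y => (1 : ℂ))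
    convert this using 1
    ext x y
    simp [Matrix.vecMulVec_apply]
  | insert a s ha ih =>
    have := (hM a (Finset.mem_insert_self a s)).hadamard
      (ih fun i hi => hM i (Finset.mem_insert_of_mem hi))
    have heq : (Matrix.of fun x y => ∏ i ∈ insert a s, M i x y) =
        (M a).hadamard (Matrix.of fun x y => ∏ i ∈ s, M i x y) := by
      ext x y
      simp [Finset.prod_insert ha]
    rw [heq]
    exact this

/-- The entrywise product of two matrices pulled back along maps. -/
theorem posSemidef_of_mul {Y Z Z' : Type*} [Fintype Y] [Fintype Z] [Fintype Z']
    {A : Matrix Z Z ℂ} {B : Matrix Z' Z' ℂ} (hA : A.PosSemidef) (hB : B.PosSemidef)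
    (f : Y → Z) (g : Y → Z') :
    (Matrix.of fun x y => A (f x) (f y) * B (g x) (g y)).PosSemidef :=
  (hA.submatrix f).hadamard (hB.submatrix g)

end OperatorInequalities

/-! ### Channels, product states and marginals -/

section Channels

/-- Complete positivity is postulated only for ancillas `Fin k`; enumerating `K` transports it to
any finite ancilla. -/
theorem posSemidef_ampliate {K X Y : Type*} [Fintype K] [Fintype X] [Fintype Y]
    {N : Matrix X X ℂ →ₗ[ℂ] Matrix Y Y ℂ} (hN : IsChannel N)
    {Z : Matrix (K × X) (K × X) ℂ} (hZ : Z.PosSemidef) : (ampliate K N Z).PosSemidef := by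
  classical
  let e := Fintype.equivFin K
  have h := hN.1 _ _ (hZ.submatrix (Prod.map e.symm id))
  have h2 := h.submatrix (Prod.map e id : K × Y → _)
  convert h2 using 1
  ext p q
  simp [ampliate]

theorem trace_ampliate {K X Y : Type*} [Fintype K] [Fintype X] [Fintype Y]
    {N : Matrix X X ℂ →ₗ[ℂ] Matrix Y Y ℂ} (hN : IsChannel N)
    (Z : Matrix (K × X) (K × X) ℂ) : (ampliate K N Z).trace = Z.trace := by
  simp only [Matrix.trace, Matrix.diag_apply, Fintype.sum_prod_type, ampliate, Matrix.of_apply]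
  refine Finset.sum_congr rfl fun k _ => ?_
  exact hN.2 (Matrix.of fun i j => Z (k, i) (k, j))

/-- The marginal of a bipartite operator on the first system. -/
def margFst {R A : Type*} [Fintype A] (σ : Matrix (R × A) (R × A) ℂ) : Matrix R R ℂ :=
  Matrix.of fun r r' => ∑ a, σ (r, a) (r', a)

theorem trace_margFst {R A : Type*} [Fintype A] [Fintype R] (σ : Matrix (R × A) (R × A) ℂ) :
    (margFst σ).trace = σ.trace := by
  simp [Matrix.trace, margFst, Fintype.sum_prod_type]

theorem posSemidef_margFst {R A : Type*} [Fintype A] [Fintype R] {σ : Matrix (R × A) (R × A) ℂ}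
    (hσ : σ.PosSemidef) : (margFst σ).PosSemidef := by
  have : margFst σ = ∑ a, σ.submatrix (fun r => (r, a)) (fun r => (r, a)) := by
    ext r r'
    simp [margFst, Matrix.sum_apply]
  rw [this]
  exact Matrix.posSemidef_sum _ fun a _ => hσ.submatrix _

theorem IsState.margFst {R A : Type*} [Fintype A] [Fintype R] {σ : Matrix (R × A) (R × A) ℂ}
    (hσ : IsState σ) : IsState (margFst σ) :=
  ⟨posSemidef_margFst hσ.1, (trace_margFst σ).trans hσ.2⟩

variable {A B C R S : Type*} [Fintype A] [Fintype B] [Fintype C] [Fintype R] [Fintype S]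

theorem IsState.macOut {N : Matrix (A × B) (A × B) ℂ →ₗ[ℂ] Matrix C C ℂ} (hN : IsChannel N)
    {σ : Matrix (R × A) (R × A) ℂ} {τ : Matrix (S × B) (S × B) ℂ} (hσ : IsState σ)
    (hτ : IsState τ) : IsState (macOut N σ τ) := by
  refine ⟨posSemidef_ampliate hN ((hσ.1.kronecker hτ.1).submatrix _), ?_⟩
  rw [EAMAC.macOut, trace_ampliate hN]
  have := Equiv.sum_comp (Equiv.prodProdProdComm R S A B) fun x => (σ ⊗ₖ τ) x x
  simp only [Matrix.trace, Matrix.diag_apply, Matrix.submatrix_apply]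
  rw [this]
  have h := Matrix.trace_kronecker σ τ
  rw [hσ.2, hτ.2, one_mul] at h
  exact h

/-- Tracing out `C` undoes the channel by trace preservation. The product form is what splits
`H(RS)` into `H(R) + H(S)`. -/
theorem margRS_macOut {N : Matrix (A × B) (A × B) ℂ →ₗ[ℂ] Matrix C C ℂ} (hN : IsChannel N)
    (σ : Matrix (R × A) (R × A) ℂ) (τ : Matrix (S × B) (S × B) ℂ) :
    margRS (macOut N σ τ) = margFst σ ⊗ₖ margFst τ := by
  ext x y
  simp only [margRS, macOut, ampliate, Matrix.of_apply]
  refine (hN.2 _).trans ?_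
  simp [Matrix.trace, Fintype.sum_prod_type, margFst, Matrix.kroneckerMap_apply,
    Finset.sum_mul_sum]

theorem margR_eq_margFst_margRS (ω : Matrix ((R × S) × C) ((R × S) × C) ℂ) :
    margR ω = margFst (margRS ω) := rfl

theorem margR_macOut {N : Matrix (A × B) (A × B) ℂ →ₗ[ℂ] Matrix C C ℂ} (hN : IsChannel N)
    (σ : Matrix (R × A) (R × A) ℂ) {τ : Matrix (S × B) (S × B) ℂ} (hτ : IsState τ) :
    margR (macOut N σ τ) = margFst σ := by
  rw [margR_eq_margFst_margRS, margRS_macOut hN]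
  ext r r'
  have h : ∑ s, margFst τ s s = 1 := (trace_margFst τ).trans hτ.2
  change ∑ s, margFst σ r r' * margFst τ s s = _
  rw [← Finset.mul_sum, h, mul_one]

theorem margS_macOut {N : Matrix (A × B) (A × B) ℂ →ₗ[ℂ] Matrix C C ℂ} (hN : IsChannel N)
    {σ : Matrix (R × A) (R × A) ℂ} (hσ : IsState σ) (τ : Matrix (S × B) (S × B) ℂ) :
    margS (macOut N σ τ) = margFst τ := by
  have h0 : margS (macOut N σ τ) =
      Matrix.of fun s s' => ∑ r, margRS (macOut N σ τ) (r, s) (r, s') := rfl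
  rw [h0, margRS_macOut hN]
  ext s s'
  have h : ∑ r, margFst σ r r = 1 := (trace_margFst σ).trans hσ.2
  change ∑ r, margFst σ r r * margFst τ s s' = _
  rw [← Finset.sum_mul, h, one_mul]

/-- Factors depending only on the reference indices are scalars for the channel and come out by
linearity. With `f`, `g` selecting one register, `a`, `b` carry the state of the unused ones. -/
theorem macOut_smul {A B C R S R' S' : Type*} (N : Matrix (A × B) (A × B) ℂ →ₗ[ℂ] Matrix C C ℂ)
    (σ : Matrix (R × A) (R × A) ℂ) (τ : Matrix (S × B) (S × B) ℂ) (f : R' → R) (g : S' → S)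
    (a : R' → R' → ℂ) (b : S' → S' → ℂ) (x y : (R' × S') × C) :
    macOut N (Matrix.of fun p q => a p.1 q.1 * σ (f p.1, p.2) (f q.1, q.2))
      (Matrix.of fun p q => b p.1 q.1 * τ (g p.1, p.2) (g q.1, q.2)) x y =
    a x.1.1 y.1.1 * b x.1.2 y.1.2 *
      macOut N σ τ ((f x.1.1, g x.1.2), x.2) ((f y.1.1, g y.1.2), y.2) := by
  have : (Matrix.of fun i j : A × B =>
      (a x.1.1 y.1.1 * σ (f x.1.1, i.1) (f y.1.1, j.1)) *
        (b x.1.2 y.1.2 * τ (g x.1.2, i.2) (g y.1.2, j.2))) =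
      (a x.1.1 y.1.1 * b x.1.2 y.1.2) • Matrix.of fun i j : A × B =>
        σ (f x.1.1, i.1) (f y.1.1, j.1) * τ (g x.1.2, i.2) (g y.1.2, j.2) := by
    ext i j
    simp only [Matrix.of_apply, Matrix.smul_apply, smul_eq_mul]
    ring
  change N (Matrix.of fun i j : A × B =>
      (a x.1.1 y.1.1 * σ (f x.1.1, i.1) (f y.1.1, j.1)) *
        (b x.1.2 y.1.2 * τ (g x.1.2, i.2) (g y.1.2, j.2))) x.2 y.2 = _
  rw [this, map_smul]
  rfl

end Channels

/-! ### Independent copies and discarding all but one of them -/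

section Copies

variable {ι X : Type*} [Fintype ι] [DecidableEq ι] [Fintype X]

theorem sum_prod_eq (f : ι → X → ℂ) : ∑ x : ι → X, ∏ i, f i (x i) = ∏ i, ∑ u, f i u :=
  (Fintype.prod_sum f).symm

theorem IsState.copies {R A : Type*} [Fintype R] [Fintype A] {θ : Matrix (R × A) (R × A) ℂ}
    (hθ : IsState θ) : IsState (copies ι θ) := by
  refine ⟨posSemidef_prod Finset.univ
    (M := fun i => θ.submatrix (fun x : (ι → R) × (ι → A) => (x.1 i, x.2 i)) _)
    fun i _ => hθ.1.submatrix _, ?_⟩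
  have h : ∑ r, ∑ a, θ (r, a) (r, a) = 1 := by
    rw [← Fintype.sum_prod_type' (f := fun r a => θ (r, a) (r, a))]; exact hθ.2
  simp only [Matrix.trace, Matrix.diag_apply, EAMAC.copies, Matrix.of_apply, Fintype.sum_prod_type]
  have h1 : ∀ x : ι → R, ∑ y : ι → A, ∏ i, θ (x i, y i) (x i, y i) =
      ∏ i, ∑ a, θ (x i, a) (x i, a) := fun x => sum_prod_eq fun i a => θ (x i, a) (x i, a)
  simp_rw [h1]
  rw [sum_prod_eq fun _ r => ∑ a, θ (r, a) (r, a)]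
  simp [h]

variable [DecidableEq X]

theorem isChannel_keep (l : ι) : IsChannel (keep (X := X) l) := by
  let e := Equiv.funSplitAt l X
  -- Splitting off coordinate `l` exhibits `keep l` as a sum of compressions over the values `w` of
  -- the other coordinates; complete positivity and trace preservation can be read off.
  have key : ∀ (Z : Matrix (ι → X) (ι → X) ℂ) (a a' : X), keep l Z a a' =
      ∑ w, Z (e.symm (a, w)) (e.symm (a', w)) := by
    intro Z a a'
    change ∑ x, (if x l = a then Z x (Function.update x l a') else 0) = _
    rw [← Equiv.sum_comp e.symm, Fintype.sum_prod_type, Finset.sum_eq_single a]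
    · refine Finset.sum_congr rfl fun w _ => ?_
      have h1 : e.symm (a, w) l = a := by simp [e, Equiv.funSplitAt, Equiv.piSplitAt]
      have h2 : Function.update (e.symm (a, w)) l a' = e.symm (a', w) := by
        ext i
        by_cases hi : i = l
        · subst hi; simp [e, Equiv.funSplitAt, Equiv.piSplitAt]
        · simp [e, Equiv.funSplitAt, Equiv.piSplitAt, hi]
      rw [if_pos h1, h2]
    · intro b _ hb
      refine Finset.sum_eq_zero fun w _ => ?_
      have h1 : e.symm (b, w) l = b := by simp [e, Equiv.funSplitAt, Equiv.piSplitAt]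
      rw [if_neg (by rwa [h1])]
    · simp
  refine ⟨fun k Z hZ => ?_, fun Z => ?_⟩
  · have : ampliate (Fin k) (keep l) Z = ∑ w, Z.submatrix
        (fun p : Fin k × X => (p.1, e.symm (p.2, w))) (fun p => (p.1, e.symm (p.2, w))) := by
      ext p q
      simp [ampliate, key, Matrix.sum_apply]
    rw [this]
    exact Matrix.posSemidef_sum _ fun w _ => hZ.submatrix _
  · simp only [Matrix.trace, Matrix.diag_apply, key]
    rw [← Equiv.sum_comp e.symm, Fintype.sum_prod_type]

theorem ampliate_keep_copies {R : Type*} (θ : Matrix (R × X) (R × X) ℂ) (l : ι) :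
    ampliate (ι → R) (keep l) (copies ι θ) =
      Matrix.of fun p q => (∏ i ∈ Finset.univ.erase l, margFst θ (p.1 i) (q.1 i)) *
        θ (p.1 l, p.2) (q.1 l, q.2) := by
  ext p q
  change ∑ x : ι → X, (if x l = p.2 then
    ∏ i, θ (p.1 i, x i) (q.1 i, Function.update x l q.2 i) else 0) = _
  -- The constraint on `x l` is absorbed into the `l`-th factor, so that the whole sum factorises
  -- over the copies.
  have h : ∀ x : ι → X, (if x l = p.2 then
      ∏ i, θ (p.1 i, x i) (q.1 i, Function.update x l q.2 i) else 0) =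
      ∏ i, (if i = l then (if x i = p.2 then θ (p.1 l, p.2) (q.1 l, q.2) else 0)
        else θ (p.1 i, x i) (q.1 i, x i)) := by
    intro x
    rw [← Finset.mul_prod_erase _ _ (Finset.mem_univ l),
      ← Finset.mul_prod_erase _ _ (Finset.mem_univ l)]
    simp only [Function.update_self, if_true]
    have : ∀ f g : ι → ℂ, (∀ i ≠ l, f i = g i) →
        ∏ i ∈ Finset.univ.erase l, f i = ∏ i ∈ Finset.univ.erase l, g i := fun f g hfg =>
      Finset.prod_congr rfl fun i hi => hfg i (Finset.ne_of_mem_erase hi)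
    by_cases hx : x l = p.2
    · simp only [hx, if_true]
      congr 1
      exact this _ _ fun i hi => by simp [hi]
    · simp [hx]
  simp_rw [h]
  rw [sum_prod_eq fun i u => if i = l then (if u = p.2 then θ (p.1 l, p.2) (q.1 l, q.2) else 0)
        else θ (p.1 i, u) (q.1 i, u), ← Finset.mul_prod_erase _ _ (Finset.mem_univ l), mul_comm]
  simp only [Matrix.of_apply, if_true, Finset.sum_ite_eq', Finset.mem_univ]
  congr 1
  refine Finset.prod_congr rfl fun i hi => ?_
  simp [Finset.ne_of_mem_erase hi, margFst]

end Copies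

/-! ### Position-based codes for a single channel use -/

section Registers

variable {d : ℕ} {R : Type*} [Fintype R] [DecidableEq R]

/-- Two configurations that agree away from `l` differ by an update at `l`. -/
theorem sum_ite_agree (l : Fin d) (x : Fin d → R) (f : (Fin d → R) → ℂ) :
    ∑ y, (if ∀ k, k ≠ l → x k = y k then f y else 0) = ∑ r, f (Function.update x l r) := by
  rw [← Finset.sum_filter]
  symm
  refine Finset.sum_bij (fun r _ => Function.update x l r) ?_ ?_ ?_ ?_
  · intro r _
    simp only [Finset.mem_filter, Finset.mem_univ, true_and]
    intro k hk
    rw [Function.update_of_ne hk]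
  · intro r _ r' _ h
    have := congrFun h l
    simpa using this
  · intro y hy
    simp only [Finset.mem_filter, Finset.mem_univ, true_and] at hy
    refine ⟨y l, Finset.mem_univ _, ?_⟩
    ext k
    by_cases hk : k = l
    · subst hk; simp
    · rw [Function.update_of_ne hk, hy k hk]
  · intros; rfl

theorem sum_prod_erase_mul (l : Fin d) (p : R → ℂ) (hp : ∑ r, p r = 1) (g : R → ℂ) :
    ∑ x : Fin d → R, (∏ k ∈ Finset.univ.erase l, p (x k)) * g (x l) = ∑ r, g r := by
  have h : ∀ x : Fin d → R, (∏ k ∈ Finset.univ.erase l, p (x k)) * g (x l) =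
      ∏ k, (if k = l then g (x k) else p (x k)) := by
    intro x
    rw [← Finset.mul_prod_erase _ _ (Finset.mem_univ l), mul_comm, if_pos rfl]
    congr 1
    exact Finset.prod_congr rfl fun i hi => by simp [Finset.ne_of_mem_erase hi]
  simp_rw [h]
  rw [sum_prod_eq fun k r => if k = l then g r else p r,
    ← Finset.mul_prod_erase _ _ (Finset.mem_univ l), Finset.prod_eq_one, mul_one]
  · simp
  intro i hi
  simp [Finset.ne_of_mem_erase hi, hp]

theorem sum_prod_erase_erase_mul {l l' : Fin d} (hl : l' ≠ l) (p : R → ℂ) (hp : ∑ r, p r = 1)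
    (g : R → R → ℂ) :
    ∑ x : Fin d → R, (∏ k ∈ (Finset.univ.erase l).erase l', p (x k)) * g (x l') (x l) =
      ∑ r, ∑ u, g r u := by
  have hmem : l' ∈ Finset.univ.erase l := Finset.mem_erase.mpr ⟨hl, Finset.mem_univ _⟩
  -- Summing over a guess `r` for `x l'` with an indicator decouples the joint dependence of `g` and
  -- turns each summand into a product over registers.
  have h : ∀ x : Fin d → R, (∏ k ∈ (Finset.univ.erase l).erase l', p (x k)) * g (x l') (x l) =
      ∑ r, ∏ k, (if k = l then g r (x k) else if k = l' then (if x k = r then 1 else 0)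
        else p (x k)) := by
    intro x
    simp_rw [← Finset.mul_prod_erase _ _ (Finset.mem_univ l), ← Finset.mul_prod_erase _ _ hmem]
    simp only [if_true, if_neg hl]
    rw [Finset.sum_eq_single (x l')]
    · rw [if_pos rfl, one_mul, mul_comm]
      congr 1
      refine Finset.prod_congr rfl fun i hi => ?_
      have h1 := Finset.ne_of_mem_erase hi
      have h2 := Finset.ne_of_mem_erase (Finset.mem_of_mem_erase hi)
      simp [h1, h2]
    · intro r _ hr
      simp [Ne.symm hr]
    · simp
  simp_rw [h]
  rw [Finset.sum_comm]
  refine Finset.sum_congr rfl fun r _ => ?_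
  rw [sum_prod_eq fun k v => if k = l then g r v else if k = l' then (if v = r then 1 else 0)
        else p v, ← Finset.mul_prod_erase _ _ (Finset.mem_univ l), Finset.prod_eq_one,
    mul_one]
  · simp
  · intro i hi
    by_cases h : i = l' <;> simp [Finset.ne_of_mem_erase hi, hp, h, hl]

/-- Contraction of an operator on the `l'`-th register against a state which is a product away from
the `l`-th register. -/
theorem sum_register (l l' : Fin d) {θ : Matrix R R ℂ} (hθ : θ.trace = 1) (F : R → R → R → R → ℂ) :
    ∑ x : Fin d → R, ∑ y : Fin d → R, (if ∀ k, k ≠ l' → x k = y k then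
        (∏ k ∈ Finset.univ.erase l, θ (y k) (x k)) * F (x l') (y l') (y l) (x l) else 0) =
      if l' = l then ∑ r, ∑ r', F r r' r' r else ∑ r, ∑ r', ∑ u, θ r' r * F r r' u u := by
  have hp : ∑ r, θ r r = 1 := hθ
  simp_rw [sum_ite_agree]
  split_ifs with h
  · subst h
    refine Finset.sum_comm.trans (Eq.trans ?_ Finset.sum_comm)
    refine Finset.sum_congr rfl fun r' _ => ?_
    rw [← sum_prod_erase_mul l' (fun r => θ r r) hp fun r => F r r' r' r]
    refine Finset.sum_congr rfl fun x _ => ?_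
    simp only [Function.update_self]
    congr 1
    exact Finset.prod_congr rfl fun i hi => by rw [Function.update_of_ne (Finset.ne_of_mem_erase hi)]
  · refine Finset.sum_comm.trans (Eq.trans ?_ Finset.sum_comm)
    refine Finset.sum_congr rfl fun r' _ => ?_
    rw [← sum_prod_erase_erase_mul h (fun r => θ r r) hp fun r u => θ r' r * F r r' u u]
    refine Finset.sum_congr rfl fun x _ => ?_
    have hmem : l' ∈ Finset.univ.erase l := Finset.mem_erase.mpr ⟨h, Finset.mem_univ _⟩
    rw [← Finset.mul_prod_erase _ _ hmem]
    simp only [Function.update_self, Function.update_of_ne (Ne.symm h)]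
    rw [mul_comm (θ r' (x l')), mul_assoc]
    congr 1
    exact Finset.prod_congr rfl fun i hi => by rw [Function.update_of_ne (Finset.ne_of_mem_erase hi)]

end Registers

theorem sum_rotate {U C : Type*} [Fintype U] [Fintype C] (f : U → C → C → ℂ) :
    ∑ u, ∑ c, ∑ c', f u c c' = ∑ c, ∑ c', ∑ u, f u c c' :=
  Finset.sum_comm.trans (Finset.sum_congr rfl fun _ _ => Finset.sum_comm)

/-! ### Statistics of a check against a codeword -/

section CheckPair

variable {R S C : Type*} [Fintype R] [Fintype S] [Fintype C]
    [DecidableEq R] [DecidableEq S] [DecidableEq C] {L M : ℕ}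

theorem posSemidef_checkPair {T : Matrix ((R × S) × C) ((R × S) × C) ℂ} (hT : T.PosSemidef)
    (l : Fin L) (m : Fin M) : (checkPair T l m).PosSemidef := by
  -- The agreement condition is the identity on the untouched registers, so `checkPair` is a Schur
  -- product of two pulled-back positive operators.
  have h1 : (1 : Matrix (({k // k ≠ l} → R) × ({k // k ≠ m} → S))
      (({k // k ≠ l} → R) × ({k // k ≠ m} → S)) ℂ).PosSemidef := Matrix.PosSemidef.one
  have h := posSemidef_of_mul h1 hT
    (fun x : ((Fin L → R) × (Fin M → S)) × C => (fun k => x.1.1 k.1, fun k => x.1.2 k.1))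
    (fun x => ((x.1.1 l, x.1.2 m), x.2))
  convert h using 1
  ext x y
  simp only [checkPair, Matrix.of_apply, Matrix.one_apply, Prod.mk.injEq, funext_iff,
    Subtype.forall, ite_mul, one_mul, zero_mul]

omit [Fintype R] [Fintype S] [Fintype C] in
theorem checkPair_one_sub (T : Matrix ((R × S) × C) ((R × S) × C) ℂ)
    (l : Fin L) (m : Fin M) : checkPair (1 - T) l m = 1 - checkPair T l m := by
  ext x y
  simp only [checkPair, Matrix.of_apply, Matrix.sub_apply, Matrix.one_apply]
  by_cases h : (∀ l', l' ≠ l → x.1.1 l' = y.1.1 l') ∧ ∀ m', m' ≠ m → x.1.2 m' = y.1.2 m'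
  · rw [if_pos h, if_pos h]
    congr 2
    simp only [eq_iff_iff]
    constructor
    · intro hx
      simp only [Prod.mk.injEq] at hx
      refine Prod.ext (Prod.ext (funext fun k => ?_) (funext fun k => ?_)) hx.2
      · by_cases hk : k = l
        · rw [hk]; exact hx.1.1
        · exact h.1 k hk
      · by_cases hk : k = m
        · rw [hk]; exact hx.1.2
        · exact h.2 k hk
    · rintro rfl; rfl
  · rw [if_neg h, if_neg h, if_neg, sub_zero]
    rintro rfl
    exact h ⟨fun _ _ => rfl, fun _ _ => rfl⟩

theorem isTest_checkPair {T : Matrix ((R × S) × C) ((R × S) × C) ℂ} (hT : IsTest T)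
    (l : Fin L) (m : Fin M) : IsTest (checkPair T l m) :=
  ⟨posSemidef_checkPair hT.1 l m, by
    rw [← checkPair_one_sub]; exact posSemidef_checkPair hT.2 l m⟩

/-- The state of the receiver when the `l`-th and `m`-th registers are sent. -/
def codeword (θ : Matrix R R ℂ) (γ : Matrix S S ℂ) (ω : Matrix ((R × S) × C) ((R × S) × C) ℂ)
    (l : Fin L) (m : Fin M) :
    Matrix (((Fin L → R) × (Fin M → S)) × C) (((Fin L → R) × (Fin M → S)) × C) ℂ :=
  Matrix.of fun x y => (∏ k ∈ Finset.univ.erase l, θ (x.1.1 k) (y.1.1 k)) *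
    (∏ k ∈ Finset.univ.erase m, γ (x.1.2 k) (y.1.2 k)) *
    ω ((x.1.1 l, x.1.2 m), x.2) ((y.1.1 l, y.1.2 m), y.2)

omit [DecidableEq R] [DecidableEq S] [DecidableEq C] in
theorem posSemidef_codeword {θ : Matrix R R ℂ} {γ : Matrix S S ℂ}
    {ω : Matrix ((R × S) × C) ((R × S) × C) ℂ} (hθ : θ.PosSemidef) (hγ : γ.PosSemidef)
    (hω : ω.PosSemidef) (l : Fin L) (m : Fin M) : (codeword θ γ ω l m).PosSemidef := by
  classical
  have h1 := posSemidef_prod (Finset.univ.erase l)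
    (M := fun k => θ.submatrix (fun x : ((Fin L → R) × (Fin M → S)) × C => x.1.1 k) _)
    fun k _ => hθ.submatrix _
  have h2 := posSemidef_prod (Finset.univ.erase m)
    (M := fun k => γ.submatrix (fun x : ((Fin L → R) × (Fin M → S)) × C => x.1.2 k) _)
    fun k _ => hγ.submatrix _
  exact (h1.hadamard h2).hadamard
    (hω.submatrix fun x : ((Fin L → R) × (Fin M → S)) × C => ((x.1.1 l, x.1.2 m), x.2))

omit [Fintype C] [DecidableEq C] in
theorem macOut_keep_copies {A B : Type*} [Fintype A] [Fintype B] [DecidableEq A] [DecidableEq B]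
    (N : Matrix (A × B) (A × B) ℂ →ₗ[ℂ] Matrix C C ℂ)
    (θ : Matrix (R × A) (R × A) ℂ) (γ : Matrix (S × B) (S × B) ℂ) (l : Fin L) (m : Fin M) :
    macOut N (ampliate (Fin L → R) (keep l) (copies (Fin L) θ))
      (ampliate (Fin M → S) (keep m) (copies (Fin M) γ)) =
      codeword (margFst θ) (margFst γ) (macOut N θ γ) l m := by
  rw [ampliate_keep_copies, ampliate_keep_copies]
  ext x y
  exact macOut_smul N θ γ (fun r : Fin L → R => r l) (fun s : Fin M → S => s m)
    (fun r r' => ∏ k ∈ Finset.univ.erase l, margFst θ (r k) (r' k))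
    (fun s s' => ∏ k ∈ Finset.univ.erase m, margFst γ (s k) (s' k)) x y

/-- The state `θ_R ⊗ ω_SC`. -/
def decoupleR (θ : Matrix R R ℂ) (ω : Matrix ((R × S) × C) ((R × S) × C) ℂ) :
    Matrix ((R × S) × C) ((R × S) × C) ℂ :=
  Matrix.of fun x y => θ x.1.1 y.1.1 * margSC ω (x.1.2, x.2) (y.1.2, y.2)

/-- The state `γ_S ⊗ ω_RC`. -/
def decoupleS (γ : Matrix S S ℂ) (ω : Matrix ((R × S) × C) ((R × S) × C) ℂ) :
    Matrix ((R × S) × C) ((R × S) × C) ℂ :=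
  Matrix.of fun x y => γ x.1.2 y.1.2 * margRC ω (x.1.1, x.2) (y.1.1, y.2)

/-- The state `θ_R ⊗ γ_S ⊗ ω_C`. -/
def decoupleRS (θ : Matrix R R ℂ) (γ : Matrix S S ℂ) (ω : Matrix ((R × S) × C) ((R × S) × C) ℂ) :
    Matrix ((R × S) × C) ((R × S) × C) ℂ :=
  (θ ⊗ₖ γ) ⊗ₖ margC ω

omit [DecidableEq R] [DecidableEq S] [DecidableEq C] in
theorem trace_mul_tripartite (T W : Matrix ((R × S) × C) ((R × S) × C) ℂ) :
    (T * W).trace = ∑ r, ∑ r', ∑ s, ∑ s', ∑ c, ∑ c',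
      T ((r, s), c) ((r', s'), c') * W ((r', s'), c') ((r, s), c) := by
  simp only [Matrix.trace, Matrix.diag_apply, Matrix.mul_apply, Fintype.sum_prod_type]
  refine Finset.sum_congr rfl fun r _ => ?_
  refine (Finset.sum_congr rfl fun s _ => Finset.sum_comm).trans ?_
  refine Finset.sum_comm.trans (Finset.sum_congr rfl fun r' _ => ?_)
  exact Finset.sum_congr rfl fun s _ => Finset.sum_comm

omit [DecidableEq C] in
-- A check on an unsent register meets a fresh marginal there, while the sent register is traced out
-- of `ω`. Only whether each index is right matters, which leaves four values.
theorem trace_checkPair_mul_codeword {θ : Matrix R R ℂ} {γ : Matrix S S ℂ} (hθ : θ.trace = 1)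
    (hγ : γ.trace = 1) (T ω : Matrix ((R × S) × C) ((R × S) × C) ℂ) (l l' : Fin L) (m m' : Fin M) :
    (checkPair T l' m' * codeword θ γ ω l m).trace =
      if l' = l then if m' = m then (T * ω).trace else (T * decoupleS γ ω).trace
      else if m' = m then (T * decoupleR θ ω).trace else (T * decoupleRS θ γ ω).trace := by
  -- With `C` contracted first, the `R` and `S` sums nest, and `sum_register` evaluates the outer
  -- and then the inner one.
  let G : R → R → R → R → S → S → S → S → ℂ := fun r₁ r₂ r₃ r₄ s₁ s₂ s₃ s₄ =>
    ∑ c, ∑ c', T ((r₁, s₁), c) ((r₂, s₂), c') * ω ((r₃, s₃), c') ((r₄, s₄), c)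
  have h0 : (checkPair T l' m' * codeword θ γ ω l m).trace =
      ∑ x : Fin L → R, ∑ y : Fin L → R, if ∀ k, k ≠ l' → x k = y k then
        (∏ k ∈ Finset.univ.erase l, θ (y k) (x k)) *
          ∑ s : Fin M → S, ∑ t : Fin M → S, (if ∀ k, k ≠ m' → s k = t k then
            (∏ k ∈ Finset.univ.erase m, γ (t k) (s k)) *
              G (x l') (y l') (y l) (x l) (s m') (t m') (t m) (s m) else 0) else 0 := by
    simp only [Matrix.trace, Matrix.diag_apply, Matrix.mul_apply, Fintype.sum_prod_type]
    refine Finset.sum_congr rfl fun x _ => ?_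
    refine (Finset.sum_congr rfl fun s _ => Finset.sum_comm).trans ?_
    refine Finset.sum_comm.trans (Finset.sum_congr rfl fun y _ => ?_)
    refine (Finset.sum_congr rfl fun s _ => Finset.sum_comm).trans ?_
    by_cases hxy : ∀ k, k ≠ l' → x k = y k
    · rw [if_pos hxy, Finset.mul_sum]
      refine Finset.sum_congr rfl fun s _ => ?_
      rw [Finset.mul_sum]
      refine Finset.sum_congr rfl fun t _ => ?_
      by_cases hst : ∀ k, k ≠ m' → s k = t k
      · rw [if_pos hst]
        simp only [G, Finset.mul_sum]
        refine Finset.sum_congr rfl fun c _ => Finset.sum_congr rfl fun c' _ => ?_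
        simp only [checkPair, codeword, Matrix.of_apply]
        rw [if_pos ⟨hxy, hst⟩]
        ring
      · rw [if_neg hst, mul_zero]
        refine Finset.sum_eq_zero fun c _ => Finset.sum_eq_zero fun c' _ => ?_
        simp only [checkPair, Matrix.of_apply]
        rw [if_neg fun h => hst h.2, zero_mul]
    · rw [if_neg hxy]
      refine Finset.sum_eq_zero fun s _ => Finset.sum_eq_zero fun t _ =>
        Finset.sum_eq_zero fun c _ => Finset.sum_eq_zero fun c' _ => ?_
      simp only [checkPair, Matrix.of_apply]
      rw [if_neg fun h => hxy h.1, zero_mul]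
  rw [h0, sum_register l l' hθ fun r₁ r₂ r₃ r₄ =>
    ∑ s : Fin M → S, ∑ t : Fin M → S, (if ∀ k, k ≠ m' → s k = t k then
            (∏ k ∈ Finset.univ.erase m, γ (t k) (s k)) *
              G r₁ r₂ r₃ r₄ (s m') (t m') (t m) (s m) else 0)]
  have hG : ∀ r₁ r₂ r₃ r₄, (∑ s : Fin M → S, ∑ t : Fin M → S, (if ∀ k, k ≠ m' → s k = t k then
            (∏ k ∈ Finset.univ.erase m, γ (t k) (s k)) *
              G r₁ r₂ r₃ r₄ (s m') (t m') (t m) (s m) else 0)) = _ :=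
    fun r₁ r₂ r₃ r₄ => sum_register m m' hγ (G r₁ r₂ r₃ r₄)
  simp only [hG]
  split_ifs with hl hm hm
  · rw [trace_mul_tripartite]
  · rw [trace_mul_tripartite]
    refine Finset.sum_congr rfl fun r _ => Finset.sum_congr rfl fun r' _ =>
      Finset.sum_congr rfl fun s _ => Finset.sum_congr rfl fun s' _ => ?_
    simp only [G, Finset.mul_sum]
    rw [sum_rotate]
    refine Finset.sum_congr rfl fun c _ => Finset.sum_congr rfl fun c' _ => ?_
    simp only [decoupleS, margRC, Matrix.of_apply, Finset.mul_sum]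
    exact Finset.sum_congr rfl fun u _ => by ring
  · rw [trace_mul_tripartite]
    refine Finset.sum_congr rfl fun r _ => Finset.sum_congr rfl fun r' _ => ?_
    simp only [Finset.mul_sum]
    refine Finset.sum_comm.trans (Finset.sum_congr rfl fun s _ =>
      Finset.sum_comm.trans (Finset.sum_congr rfl fun s' _ => ?_))
    simp only [G, Finset.mul_sum]
    rw [sum_rotate]
    refine Finset.sum_congr rfl fun c _ => Finset.sum_congr rfl fun c' _ => ?_
    simp only [decoupleR, margSC, Matrix.of_apply, Finset.mul_sum]
    exact Finset.sum_congr rfl fun u _ => by ring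
  · rw [trace_mul_tripartite]
    refine Finset.sum_congr rfl fun r _ => Finset.sum_congr rfl fun r' _ => ?_
    simp only [Finset.mul_sum]
    refine Finset.sum_comm.trans (Finset.sum_congr rfl fun s _ =>
      Finset.sum_comm.trans (Finset.sum_congr rfl fun s' _ => ?_))
    simp only [G, Finset.mul_sum]
    simp only [sum_rotate]
    refine Finset.sum_congr rfl fun c _ => Finset.sum_congr rfl fun c' _ => ?_
    simp only [decoupleRS, margC, Matrix.of_apply, Matrix.kroneckerMap_apply, Finset.mul_sum]
    exact Finset.sum_congr rfl fun u _ => Finset.sum_congr rfl fun v _ => by ring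

end CheckPair

/-! ### One-shot error bound for the square-root measurement -/

section OneShot

theorem sum_ite_fin {d : ℕ} (m : Fin d) (a b : ℝ) :
    ∑ k, (if k = m then a else b) = a + ((d : ℝ) - 1) * b := by
  have : ∀ k : Fin d, (if k = m then a else b) = (if k = m then a - b else 0) + b := fun k => by
    split_ifs <;> ring
  simp_rw [this, Finset.sum_add_distrib]
  simp
  ring

variable {A B C R S : Type*} [Fintype A] [Fintype B] [Fintype C] [Fintype R] [Fintype S]
  [DecidableEq A] [DecidableEq B] [DecidableEq C] [DecidableEq R] [DecidableEq S]

theorem posSemidef_squareRootMeas {X : Type*} [Fintype X] [DecidableEq X] {L M : ℕ}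
    {Γ : Fin L → Fin M → Matrix X X ℂ} (hΓ : ∀ l m, (Γ l m).PosSemidef) (l : Fin L) (m : Fin M) :
    (squareRootMeas Γ l m).PosSemidef := by
  have h := (hΓ l m).conjTranspose_mul_mul_same (invSqrt (∑ l', ∑ m', Γ l' m'))
  have hH : (invSqrt (∑ l', ∑ m', Γ l' m')).IsHermitian := isHermitian_cfc _ _
  rwa [hH.eq] at h

theorem squareRootMeas_sum_le {X : Type*} [Fintype X] [DecidableEq X] {L M : ℕ}
    {Γ : Fin L → Fin M → Matrix X X ℂ} (hΓ : ∀ l m, (Γ l m).PosSemidef) :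
    (1 - ∑ l, ∑ m, squareRootMeas Γ l m).PosSemidef := by
  have h := invSqrt_mul_self_mul_invSqrt_le
    (Matrix.posSemidef_sum Finset.univ fun l _ => Matrix.posSemidef_sum Finset.univ fun m _ => hΓ l m)
  convert h using 2
  simp only [squareRootMeas, ← Finset.sum_mul, ← Finset.mul_sum]

/-- The position-based code with test operator `T`. -/
noncomputable def positionCode (N : Matrix (A × B) (A × B) ℂ →ₗ[ℂ] Matrix C C ℂ)
    {θ : Matrix (R × A) (R × A) ℂ} (hθ : IsState θ) {γ : Matrix (S × B) (S × B) ℂ} (hγ : IsState γ)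
    {T : Matrix ((R × S) × C) ((R × S) × C) ℂ} (hT : IsTest T) (L M : ℕ) :
    Code N (Fin L → R) (Fin L → A) (Fin M → S) (Fin M → B) L M where
  Φ := copies (Fin L) θ
  Ψ := copies (Fin M) γ
  encA := keep
  encB := keep
  povm := squareRootMeas fun l m => checkPair T l m
  isState_Φ := hθ.copies
  isState_Ψ := hγ.copies
  isChannel_encA := isChannel_keep
  isChannel_encB := isChannel_keep
  povm_nonneg := posSemidef_squareRootMeas fun l m => posSemidef_checkPair hT.1 l m
  povm_sum_le := squareRootMeas_sum_le fun l m => posSemidef_checkPair hT.1 l m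

theorem isPositionBased_positionCode (N : Matrix (A × B) (A × B) ℂ →ₗ[ℂ] Matrix C C ℂ)
    {θ : Matrix (R × A) (R × A) ℂ} (hθ : IsState θ) {γ : Matrix (S × B) (S × B) ℂ} (hγ : IsState γ)
    {T : Matrix ((R × S) × C) ((R × S) × C) ℂ} (hT : IsTest T) (L M : ℕ) :
    IsPositionBased θ γ (positionCode N hθ hγ hT L M) :=
  ⟨rfl, rfl, fun _ => rfl, fun _ => rfl, T, hT, fun _ _ => rfl⟩

/-- Hayashi–Nagaoka is applied with the correct check as `S` and the sum of all other checks as `T`.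
Grouping the wrong pairs by which index is wrong gives the three counts; the bound is the same for
all `(l, m)`, so averaging costs nothing. -/
theorem errorProb_positionCode_le (N : Matrix (A × B) (A × B) ℂ →ₗ[ℂ] Matrix C C ℂ)
    {θ : Matrix (R × A) (R × A) ℂ} (hθ : IsState θ) {γ : Matrix (S × B) (S × B) ℂ} (hγ : IsState γ)
    {T : Matrix ((R × S) × C) ((R × S) × C) ℂ} (hT : IsTest T) (hω : (macOut N θ γ).PosSemidef)
    {L M : ℕ} (l : Fin L) (m : Fin M) :
    (positionCode N hθ hγ hT L M).errorProb l m ≤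
      2 * ((1 - T) * macOut N θ γ).trace.re +
      4 * (((L : ℝ) - 1) * (T * decoupleR (margFst θ) (macOut N θ γ)).trace.re +
        ((M : ℝ) - 1) * (T * decoupleS (margFst γ) (macOut N θ γ)).trace.re +
        ((L : ℝ) - 1) * ((M : ℝ) - 1) *
          (T * decoupleRS (margFst θ) (margFst γ) (macOut N θ γ)).trace.re) := by
  set ω := macOut N θ γ with hωdef
  set Ω := codeword (margFst θ) (margFst γ) ω l m with hΩ
  have hΩp : Ω.PosSemidef := posSemidef_codeword hθ.margFst.1 hγ.margFst.1 hω l m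
  have htr : ∀ l' m', (checkPair T l' m' * Ω).trace = _ := fun l' m' =>
    trace_checkPair_mul_codeword hθ.margFst.2 hγ.margFst.2 T ω l l' m m'
  set W := ∑ l', ∑ m', checkPair T l' m' with hW
  have hrest : (W - checkPair T l m).PosSemidef := by
    have : W - checkPair T l m = ∑ p ∈ Finset.univ.erase (l, m), checkPair T p.1 p.2 := by
      rw [hW, ← Fintype.sum_prod_type' (f := fun l' m' => checkPair T l' m'),
        ← Finset.add_sum_erase _ _ (Finset.mem_univ (l, m)), add_sub_cancel_left]
    rw [this]
    exact Matrix.posSemidef_sum _ fun p _ => posSemidef_checkPair hT.1 _ _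
  have hHN := hayashi_nagaoka (isTest_checkPair hT l m) hrest
  rw [add_sub_cancel] at hHN
  have h1 : (positionCode N hθ hγ hT L M).errorProb l m =
      ((1 - invSqrt W * checkPair T l m * invSqrt W) * Ω).trace.re := by
    simp only [Code.errorProb, positionCode, macOut_keep_copies]
    rfl
  rw [h1]
  refine (trace_mul_re_le hHN hΩp).trans (le_of_eq ?_)
  have h2 : ((1 - checkPair T l m) * Ω).trace = ((1 - T) * ω).trace := by
    rw [← checkPair_one_sub, trace_checkPair_mul_codeword hθ.margFst.2 hγ.margFst.2, if_pos rfl,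
      if_pos rfl]
  have h3 : (checkPair T l m * Ω).trace = (T * ω).trace := by
    rw [htr, if_pos rfl, if_pos rfl]
  have h4 : (W * Ω).trace.re = (T * ω).trace.re +
      ((M : ℝ) - 1) * (T * decoupleS (margFst γ) ω).trace.re +
      ((L : ℝ) - 1) * ((T * decoupleR (margFst θ) ω).trace.re +
        ((M : ℝ) - 1) * (T * decoupleRS (margFst θ) (margFst γ) ω).trace.re) := by
    simp only [hW, Finset.sum_mul, Matrix.trace_sum, Complex.re_sum, htr, apply_ite Complex.re]
    rw [← sum_ite_fin m, ← sum_ite_fin m, ← sum_ite_fin l]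
    refine Finset.sum_congr rfl fun l' _ => ?_
    split_ifs <;> rfl
  rw [Matrix.add_mul, Matrix.trace_add, Matrix.smul_mul, Matrix.smul_mul, Matrix.trace_smul,
    Matrix.trace_smul, Complex.add_re, Complex.smul_re, Complex.smul_re, h2, Matrix.sub_mul W,
    Matrix.trace_sub, Complex.sub_re, h3, h4]
  simp only [smul_eq_mul]
  ring

theorem avgError_positionCode_le (N : Matrix (A × B) (A × B) ℂ →ₗ[ℂ] Matrix C C ℂ)
    {θ : Matrix (R × A) (R × A) ℂ} (hθ : IsState θ) {γ : Matrix (S × B) (S × B) ℂ} (hγ : IsState γ)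
    {T : Matrix ((R × S) × C) ((R × S) × C) ℂ} (hT : IsTest T) (hω : (macOut N θ γ).PosSemidef)
    {L M : ℕ} (hL : 0 < L) (hM : 0 < M) :
    (positionCode N hθ hγ hT L M).avgError ≤
      2 * ((1 - T) * macOut N θ γ).trace.re +
      4 * (((L : ℝ) - 1) * (T * decoupleR (margFst θ) (macOut N θ γ)).trace.re +
        ((M : ℝ) - 1) * (T * decoupleS (margFst γ) (macOut N θ γ)).trace.re +
        ((L : ℝ) - 1) * ((M : ℝ) - 1) *
          (T * decoupleRS (margFst θ) (margFst γ) (macOut N θ γ)).trace.re) := by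
  have hLM : (0 : ℝ) < L * M := by positivity
  rw [Code.avgError, one_div, inv_mul_le_iff₀ hLM]
  refine (Finset.sum_le_sum fun l _ => Finset.sum_le_sum fun m _ =>
    errorProb_positionCode_le N hθ hγ hT hω l m).trans (le_of_eq ?_)
  simp only [Finset.sum_const, Finset.card_univ, Fintype.card_fin, nsmul_eq_mul]
  ring

end OneShot

/-! ### Typical projections -/

section Chernoff

theorem exists_pos_lt_of_hasDerivAt {F : ℝ → ℝ} {D : ℝ} (hF : HasDerivAt F D 0) (hD : D < 0) :
    ∃ s, 0 < s ∧ F s < F 0 := by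
  have h1 := hF.tendsto_slope.eventually (eventually_lt_nhds hD)
  have h2 : ∀ᶠ s in nhdsWithin (0 : ℝ) (Set.Ioi 0), slope F 0 s < 0 :=
    h1.filter_mono (nhdsWithin_mono _ fun x hx => ne_of_gt hx)
  obtain ⟨s, hs, hpos⟩ := (h2.and self_mem_nhdsWithin).exists
  refine ⟨s, hpos, ?_⟩
  have hpos' : (0 : ℝ) < s := hpos
  rw [slope_def_field, sub_zero] at hs
  have := (div_lt_iff₀ hpos').mp hs
  linarith

variable {X : Type*} [Fintype X]

/-- The prefactor `p a` makes terms of zero probability vanish identically, so the power of zero is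
harmless. -/
theorem hasDerivAt_sum_mul_rpow {p : X → ℝ} (hp : ∀ a, 0 ≤ p a) {c : ℝ} (hc : 0 < c) :
    HasDerivAt (fun s : ℝ => ∑ a, p a * (c * p a) ^ s) (∑ a, p a * Real.log (c * p a)) 0 := by
  refine HasDerivAt.fun_sum fun a _ => ?_
  rcases (hp a).eq_or_lt with h | h
  · simp only [← h, zero_mul]
    exact hasDerivAt_const _ _
  · have h1 : HasDerivAt (fun s : ℝ => (c * p a) ^ s) (Real.log (c * p a)) 0 := by
      simpa using Real.hasStrictDerivAt_const_rpow (mul_pos hc h) 0 |>.hasDerivAt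
    exact h1.const_mul _

/-- Markov's inequality in exponential form: off `K` each probability is multiplied by a factor of
at least one, and the full sum then factorises. Zero-probability sequences are exempted in `hK` to
allow negative `s`. -/
theorem chernoff_bound {p : X → ℝ} (hp : ∀ a, 0 ≤ p a) {c s : ℝ} (hc : 0 < c) {n : ℕ}
    (K : (Fin n → X) → Prop) [DecidablePred K]
    (hK : ∀ x, ¬ K x → 0 < ∏ i, p (x i) → 1 ≤ (∏ i, (c * p (x i))) ^ s) :
    ∑ x, (if K x then 0 else ∏ i, p (x i)) ≤ (∑ a, p a * (c * p a) ^ s) ^ n := by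
  have hg : ∀ a, 0 ≤ p a * (c * p a) ^ s := fun a =>
    mul_nonneg (hp a) (Real.rpow_nonneg (mul_nonneg hc.le (hp a)) s)
  have h1 : (∑ a, p a * (c * p a) ^ s) ^ n = ∑ x : Fin n → X, ∏ i, (p (x i) * (c * p (x i)) ^ s) := by
    rw [← Fintype.prod_sum (fun (_ : Fin n) a => p a * (c * p a) ^ s)]
    simp
  rw [h1]
  refine Finset.sum_le_sum fun x _ => ?_
  have hnn : 0 ≤ ∏ i, (p (x i) * (c * p (x i)) ^ s) := Finset.prod_nonneg fun i _ => hg (x i)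
  split_ifs with hx
  · exact hnn
  · rcases (Finset.prod_nonneg fun _ _ => hp _ : 0 ≤ ∏ i, p (x i)).eq_or_lt with h | h
    · rw [← h]; exact hnn
    · rw [Finset.prod_mul_distrib,
        Real.finsetProd_rpow _ _ (fun i _ => mul_nonneg hc.le (hp (x i)))]
      exact le_mul_of_one_le_right h.le (hK x hx h)

/-- Shannon entropy in bits. -/
noncomputable def shannon (p : X → ℝ) : ℝ := ∑ a, -(p a * Real.logb 2 (p a))

theorem sum_mul_log {p : X → ℝ} (hp : ∀ a, 0 ≤ p a) (h1 : ∑ a, p a = 1) (t : ℝ) :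
    ∑ a, p a * Real.log ((2 : ℝ) ^ t * p a) = (t - shannon p) * Real.log 2 := by
  have hlog : Real.log 2 ≠ 0 := (Real.log_pos one_lt_two).ne'
  have h2 : ∀ a, p a * Real.log ((2 : ℝ) ^ t * p a) =
      t * Real.log 2 * p a + (p a * Real.logb 2 (p a)) * Real.log 2 := by
    intro a
    rcases (hp a).eq_or_lt with h | h
    · simp [← h]
    · rw [Real.log_mul (by positivity) h.ne', Real.log_rpow two_pos, Real.logb]
      field_simp
  simp_rw [h2, Finset.sum_add_distrib, ← Finset.mul_sum, ← Finset.sum_mul, h1, shannon,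
    Finset.sum_neg_distrib]
  ring

/-- The Chernoff base is `1` at `s = 0` with derivative `(t - shannon p) log 2 < 0`, so a small
positive `s` brings it below one. -/
theorem exists_tail_bound_above {p : X → ℝ} (hp : ∀ a, 0 ≤ p a) (h1 : ∑ a, p a = 1) {t : ℝ}
    (ht : t < shannon p) :
    ∃ q : ℝ, 0 ≤ q ∧ q < 1 ∧ ∀ n : ℕ,
      ∑ x : Fin n → X, (if ∏ i, ((2 : ℝ) ^ t * p (x i)) ≤ 1 then 0 else ∏ i, p (x i)) ≤ q ^ n := by
  have hc : (0 : ℝ) < 2 ^ t := Real.rpow_pos_of_pos two_pos t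
  have hd := hasDerivAt_sum_mul_rpow hp hc
  rw [sum_mul_log hp h1] at hd
  obtain ⟨s, hs, hlt⟩ := exists_pos_lt_of_hasDerivAt hd
    (mul_neg_of_neg_of_pos (by linarith) (Real.log_pos one_lt_two))
  refine ⟨_, Finset.sum_nonneg fun a _ =>
    mul_nonneg (hp a) (Real.rpow_nonneg (mul_nonneg hc.le (hp a)) s), by simpa [h1] using hlt,
    fun n => chernoff_bound hp hc _ fun x hx _ => ?_⟩
  exact Real.one_le_rpow (not_le.mp hx).le hs.le

theorem exists_tail_bound_below {p : X → ℝ} (hp : ∀ a, 0 ≤ p a) (h1 : ∑ a, p a = 1) {t : ℝ}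
    (ht : shannon p < t) :
    ∃ q : ℝ, 0 ≤ q ∧ q < 1 ∧ ∀ n : ℕ,
      ∑ x : Fin n → X, (if 1 ≤ ∏ i, ((2 : ℝ) ^ t * p (x i)) then 0 else ∏ i, p (x i)) ≤ q ^ n := by
  have hc : (0 : ℝ) < 2 ^ t := Real.rpow_pos_of_pos two_pos t
  have hd := hasDerivAt_sum_mul_rpow hp hc
  rw [sum_mul_log hp h1, ← neg_zero] at hd
  -- The derivative is now positive, so the base falls below one for a negative exponent; reflecting
  -- `s` reduces this to the previous situation.
  have hd' := hd.scomp (0 : ℝ) (hasDerivAt_neg (0 : ℝ))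
  obtain ⟨s, hs, hlt⟩ := exists_pos_lt_of_hasDerivAt hd' (by
    have := mul_pos (sub_pos.mpr ht) (Real.log_pos one_lt_two)
    simpa using this)
  refine ⟨_, Finset.sum_nonneg fun a _ =>
    mul_nonneg (hp a) (Real.rpow_nonneg (mul_nonneg hc.le (hp a)) (-s)), by simpa [h1] using hlt,
    fun n => chernoff_bound hp hc _ fun x hx hpos => ?_⟩
  refine Real.one_le_rpow_of_pos_of_le_one_of_nonpos ?_ (not_le.mp hx).le (neg_nonpos.mpr hs.le)
  rw [Finset.prod_mul_distrib]
  exact mul_pos (Finset.prod_pos fun _ _ => hc) hpos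

end Chernoff

/-! ### Tensor powers of operators -/

section TensorPower

variable {X : Type*} {n : ℕ}

/-- Tensor powers of an operator. -/
def tensorPow (n : ℕ) (ρ : Matrix X X ℂ) : Matrix (Fin n → X) (Fin n → X) ℂ :=
  Matrix.of fun x y => ∏ i, ρ (x i) (y i)

theorem posSemidef_tensorPow [Fintype X] {ρ : Matrix X X ℂ} (hρ : ρ.PosSemidef) :
    (tensorPow n ρ).PosSemidef :=
  posSemidef_prod Finset.univ (M := fun i => ρ.submatrix (fun x : Fin n → X => x i) fun x => x i)
    fun i _ => hρ.submatrix _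

theorem tensorPow_mul [Fintype X] (ρ σ : Matrix X X ℂ) :
    tensorPow n (ρ * σ) = tensorPow n ρ * tensorPow n σ := by
  ext x y
  simp only [tensorPow, Matrix.of_apply, Matrix.mul_apply, Fintype.prod_sum,
    Finset.prod_mul_distrib]

theorem trace_tensorPow [Fintype X] (ρ : Matrix X X ℂ) : (tensorPow n ρ).trace = ρ.trace ^ n := by
  simp only [tensorPow, Matrix.trace, Matrix.diag_apply, Matrix.of_apply]
  rw [sum_prod_eq fun _ a => ρ a a]
  simp

theorem IsState.tensorPow [Fintype X] {ρ : Matrix X X ℂ} (hρ : IsState ρ) :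
    IsState (tensorPow n ρ) :=
  ⟨posSemidef_tensorPow hρ.1, by rw [trace_tensorPow, hρ.2, one_pow]⟩

theorem tensorPow_conjTranspose (ρ : Matrix X X ℂ) :
    tensorPow n ρ.conjTranspose = (tensorPow n ρ).conjTranspose := by
  ext x y
  simp [tensorPow]

theorem tensorPow_diagonal [DecidableEq X] (d : X → ℂ) :
    tensorPow n (Matrix.diagonal d) = Matrix.diagonal fun x => ∏ i, d (x i) := by
  ext x y
  simp only [tensorPow, Matrix.of_apply, Matrix.diagonal_apply]
  split_ifs with h
  · subst h; simp
  · obtain ⟨i, hi⟩ := Function.ne_iff.mp h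
    exact Finset.prod_eq_zero (Finset.mem_univ i) (by simp [hi])

theorem tensorPow_one [DecidableEq X] : tensorPow n (1 : Matrix X X ℂ) = 1 := by
  rw [← Matrix.diagonal_one, tensorPow_diagonal]
  simp

end TensorPower

/-! ### One-sided typical projections -/

section Typical

variable {X : Type*} [Fintype X] [DecidableEq X]

/-- An orthogonal projection. -/
def IsProjection {X : Type*} [Fintype X] (P : Matrix X X ℂ) : Prop :=
  P.IsHermitian ∧ P * P = P

theorem exists_diagonalization {ρ : Matrix X X ℂ} (hρ : IsState ρ) :
    ∃ (U : Matrix X X ℂ) (p : X → ℝ), U.conjTranspose * U = 1 ∧ U * U.conjTranspose = 1 ∧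
      ρ = U * Matrix.diagonal (fun a => (p a : ℂ)) * U.conjTranspose ∧ (∀ a, 0 ≤ p a) ∧
      ∑ a, p a = 1 ∧ entropy ρ = shannon p := by
  have hH := hρ.1.1
  refine ⟨hH.eigenvectorUnitary, hH.eigenvalues, ?_, ?_, ?_, hρ.1.eigenvalues_nonneg, ?_, ?_⟩
  · exact Unitary.coe_star_mul_self hH.eigenvectorUnitary
  · exact Unitary.coe_mul_star_self hH.eigenvectorUnitary
  · exact hH.spectral_theorem
  · have h := hH.trace_eq_sum_eigenvalues
    rw [hρ.2] at h
    have h' := congrArg Complex.re h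
    simpa using h'.symm
  · rw [entropy, hH.cfc_eq, Matrix.IsHermitian.cfc, Unitary.conjStarAlgAut_apply,
      Matrix.trace_mul_comm, ← Matrix.mul_assoc, Unitary.coe_star_mul_self, Matrix.one_mul,
      Matrix.trace_diagonal]
    simp [shannon]

/-- Diagonal operators in a rotated basis. -/
theorem conj_mul_conj {Y : Type*} [Fintype Y] [DecidableEq Y] {V : Matrix Y Y ℂ}
    (hV : V.conjTranspose * V = 1) (d e : Y → ℂ) :
    (V * Matrix.diagonal d * V.conjTranspose) * (V * Matrix.diagonal e * V.conjTranspose) =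
      V * Matrix.diagonal (fun y => d y * e y) * V.conjTranspose := by
  calc _ = V * Matrix.diagonal d * (V.conjTranspose * V) * Matrix.diagonal e * V.conjTranspose := by
        simp only [Matrix.mul_assoc]
    _ = _ := by rw [hV, Matrix.mul_one, Matrix.mul_assoc V, Matrix.diagonal_mul_diagonal]

theorem isHermitian_conj {Y : Type*} [Fintype Y] [DecidableEq Y] (V : Matrix Y Y ℂ) (d : Y → ℝ) :
    (V * Matrix.diagonal (fun y => (d y : ℂ)) * V.conjTranspose).IsHermitian := by
  refine Matrix.isHermitian_mul_mul_conjTranspose V ?_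
  rw [Matrix.isHermitian_diagonal_iff]
  intro y
  exact Complex.conj_ofReal _

theorem posSemidef_conj {Y : Type*} [Fintype Y] [DecidableEq Y] (V : Matrix Y Y ℂ) {d : Y → ℝ}
    (hd : ∀ y, 0 ≤ d y) :
    (V * Matrix.diagonal (fun y => (d y : ℂ)) * V.conjTranspose).PosSemidef :=
  (Matrix.PosSemidef.diagonal fun y => by simpa using hd y).mul_mul_conjTranspose_same V

theorem trace_conj {Y : Type*} [Fintype Y] [DecidableEq Y] {V : Matrix Y Y ℂ}
    (hV : V.conjTranspose * V = 1) (d : Y → ℂ) :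
    (V * Matrix.diagonal d * V.conjTranspose).trace = ∑ y, d y := by
  rw [Matrix.trace_mul_comm, ← Matrix.mul_assoc, hV, Matrix.one_mul, Matrix.trace_diagonal]

theorem exists_diagonalization_tensorPow {ρ : Matrix X X ℂ} (hρ : IsState ρ) :
    ∃ p : X → ℝ, (∀ a, 0 ≤ p a) ∧ ∑ a, p a = 1 ∧ entropy ρ = shannon p ∧
      ∀ n, ∃ V : Matrix (Fin n → X) (Fin n → X) ℂ, V.conjTranspose * V = 1 ∧
        V * V.conjTranspose = 1 ∧ tensorPow n ρ =
          V * Matrix.diagonal (fun x => ((∏ i, p (x i) : ℝ) : ℂ)) * V.conjTranspose := by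
  obtain ⟨U, p, hU, hU', hρU, hp, hp1, hent⟩ := exists_diagonalization hρ
  refine ⟨p, hp, hp1, hent, fun n => ⟨tensorPow n U, ?_, ?_, ?_⟩⟩
  · rw [← tensorPow_conjTranspose, ← tensorPow_mul, hU, tensorPow_one]
  · rw [← tensorPow_conjTranspose, ← tensorPow_mul, hU', tensorPow_one]
  · rw [hρU, tensorPow_mul, tensorPow_mul, tensorPow_diagonal, tensorPow_conjTranspose]
    simp

/-- The spectral projection of a predicate on the diagonalizing basis. -/
def spectralProj {Y : Type*} [Fintype Y] [DecidableEq Y] (V : Matrix Y Y ℂ) (K : Y → Prop)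
    [DecidablePred K] : Matrix Y Y ℂ :=
  V * Matrix.diagonal (fun y => (((if K y then 1 else 0 : ℝ)) : ℂ)) * V.conjTranspose

theorem isProjection_spectralProj {Y : Type*} [Fintype Y] [DecidableEq Y] {V : Matrix Y Y ℂ}
    (hV : V.conjTranspose * V = 1) (K : Y → Prop) [DecidablePred K] :
    IsProjection (spectralProj V K) := by
  refine ⟨isHermitian_conj V _, ?_⟩
  rw [spectralProj, conj_mul_conj hV]
  congr 3
  ext x
  split_ifs <;> simp

theorem trace_one_sub_spectralProj_mul {Y : Type*} [Fintype Y] [DecidableEq Y] {V : Matrix Y Y ℂ}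
    (hV : V.conjTranspose * V = 1) (hV' : V * V.conjTranspose = 1) (K : Y → Prop)
    [DecidablePred K] (d : Y → ℝ) :
    ((1 - spectralProj V K) *
      (V * Matrix.diagonal (fun y => (d y : ℂ)) * V.conjTranspose)).trace.re =
      ∑ y, if K y then 0 else d y := by
  have h1 : 1 - spectralProj V K = V * Matrix.diagonal
      (fun x => 1 - (((if K x then 1 else 0 : ℝ)) : ℂ)) * V.conjTranspose := by
    rw [← Matrix.diagonal_sub, Matrix.mul_sub, Matrix.sub_mul, Matrix.diagonal_one,
      Matrix.mul_one, hV', spectralProj]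
  rw [h1, conj_mul_conj hV, trace_conj hV, Complex.re_sum]
  refine Finset.sum_congr rfl fun x _ => ?_
  split_ifs <;> simp

/-- `Q` keeps the eigenvalues of at least `2^{-nt}`, so `2^{nt} ρ^{⊗n}` is at least one on its
range. -/
theorem exists_dominated_projection {ρ : Matrix X X ℂ} (hρ : IsState ρ) {t : ℝ}
    (ht : entropy ρ < t) :
    ∃ q : ℝ, 0 ≤ q ∧ q < 1 ∧ ∀ n : ℕ, ∃ Q : Matrix (Fin n → X) (Fin n → X) ℂ, IsProjection Q ∧
      (((2 : ℝ) ^ t) ^ n • tensorPow n ρ - Q).PosSemidef ∧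
      ((1 - Q) * tensorPow n ρ).trace.re ≤ q ^ n := by
  obtain ⟨p, hp, hp1, hent, hdiag⟩ := exists_diagonalization_tensorPow hρ
  rw [hent] at ht
  obtain ⟨q, hq0, hq1, hq⟩ := exists_tail_bound_below hp hp1 ht
  refine ⟨q, hq0, hq1, fun n => ?_⟩
  obtain ⟨V, hV, hV', hpow⟩ := hdiag n
  refine ⟨spectralProj V fun x => 1 ≤ ∏ i, ((2 : ℝ) ^ t * p (x i)),
    isProjection_spectralProj hV _, ?_, ?_⟩
  · have : ((2 : ℝ) ^ t) ^ n • tensorPow n ρ -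
        spectralProj V (fun x => 1 ≤ ∏ i, ((2 : ℝ) ^ t * p (x i))) = V * Matrix.diagonal
          (fun x => ((∏ i, ((2 : ℝ) ^ t * p (x i)) -
            (if 1 ≤ ∏ i, ((2 : ℝ) ^ t * p (x i)) then 1 else 0) : ℝ) : ℂ)) * V.conjTranspose := by
      rw [hpow, spectralProj, ← Matrix.smul_mul, ← Matrix.mul_smul, ← Matrix.sub_mul,
        ← Matrix.mul_sub, ← Matrix.diagonal_smul, Matrix.diagonal_sub]
      congr 3
      ext x
      simp [Finset.prod_mul_distrib]
    rw [this]
    refine posSemidef_conj V fun x => ?_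
    split_ifs with h
    · linarith
    · rw [sub_zero]
      exact Finset.prod_nonneg fun i _ => mul_nonneg (Real.rpow_nonneg two_pos.le _) (hp _)
  · rw [hpow, trace_one_sub_spectralProj_mul hV hV']
    exact hq n

/-- The opposite one-sided cut: `P` keeps the eigenvalues of at most `2^{-nt}`. -/
theorem exists_flattening_projection {ρ : Matrix X X ℂ} (hρ : IsState ρ) {t : ℝ}
    (ht : t < entropy ρ) :
    ∃ q : ℝ, 0 ≤ q ∧ q < 1 ∧ ∀ n : ℕ, ∃ P : Matrix (Fin n → X) (Fin n → X) ℂ, IsProjection P ∧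
      ((((2 : ℝ) ^ t) ^ n)⁻¹ • 1 - P * tensorPow n ρ * P).PosSemidef ∧
      ((1 - P) * tensorPow n ρ).trace.re ≤ q ^ n := by
  obtain ⟨p, hp, hp1, hent, hdiag⟩ := exists_diagonalization_tensorPow hρ
  rw [hent] at ht
  obtain ⟨q, hq0, hq1, hq⟩ := exists_tail_bound_above hp hp1 ht
  refine ⟨q, hq0, hq1, fun n => ?_⟩
  obtain ⟨V, hV, hV', hpow⟩ := hdiag n
  let k : (Fin n → X) → ℝ := fun x => if ∏ i, ((2 : ℝ) ^ t * p (x i)) ≤ 1 then 1 else 0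
  refine ⟨spectralProj V fun x => ∏ i, ((2 : ℝ) ^ t * p (x i)) ≤ 1,
    isProjection_spectralProj hV _, ?_, ?_⟩
  · have : (((2 : ℝ) ^ t) ^ n)⁻¹ • (1 : Matrix (Fin n → X) (Fin n → X) ℂ) -
        spectralProj V (fun x => ∏ i, ((2 : ℝ) ^ t * p (x i)) ≤ 1) * tensorPow n ρ *
          spectralProj V (fun x => ∏ i, ((2 : ℝ) ^ t * p (x i)) ≤ 1) = V * Matrix.diagonal
          (fun x => (((((2 : ℝ) ^ t) ^ n)⁻¹ - k x * (∏ i, p (x i)) * k x : ℝ) : ℂ)) *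
            V.conjTranspose := by
      rw [hpow, spectralProj, conj_mul_conj hV, conj_mul_conj hV]
      nth_rw 1 [← hV']
      nth_rw 1 [← Matrix.mul_one V]
      rw [← Matrix.smul_mul, ← Matrix.mul_smul, ← Matrix.sub_mul, ← Matrix.mul_sub,
        ← Matrix.diagonal_one, ← Matrix.diagonal_smul, Matrix.diagonal_sub]
      congr 3
      ext x
      by_cases h : ∏ i, ((2 : ℝ) ^ t * p (x i)) ≤ 1 <;> simp [k, h]
    rw [this]
    refine posSemidef_conj V fun x => ?_
    have hc : (0 : ℝ) < ((2 : ℝ) ^ t) ^ n := by positivity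
    simp only [k]
    split_ifs with h
    · rw [Finset.prod_mul_distrib, Finset.prod_const, Finset.card_univ, Fintype.card_fin] at h
      rw [one_mul, mul_one, sub_nonneg, ← one_div, le_div_iff₀ hc, mul_comm]
      exact h
    · simp only [zero_mul, sub_zero]
      positivity
  · rw [hpow, trace_one_sub_spectralProj_mul hV hV']
    exact hq n

end Typical

/-! ### Test operators built from typical projections -/

section Projections

variable {X Y : Type*} [Fintype X] [DecidableEq X] [Fintype Y] [DecidableEq Y]

theorem IsProjection.posSemidef {P : Matrix X X ℂ} (hP : IsProjection P) : P.PosSemidef := by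
  have h := Matrix.posSemidef_conjTranspose_mul_self P
  rwa [hP.1.eq, hP.2] at h

theorem IsProjection.one_sub {P : Matrix X X ℂ} (hP : IsProjection P) : IsProjection (1 - P) :=
  ⟨Matrix.isHermitian_one.sub hP.1, by
    rw [Matrix.mul_sub, Matrix.sub_mul, Matrix.sub_mul, hP.2]; simp⟩

theorem IsProjection.one : IsProjection (1 : Matrix X X ℂ) :=
  ⟨Matrix.isHermitian_one, Matrix.one_mul 1⟩

theorem IsProjection.kronecker {P : Matrix X X ℂ} {Q : Matrix Y Y ℂ} (hP : IsProjection P)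
    (hQ : IsProjection Q) : IsProjection (P ⊗ₖ Q) :=
  ⟨(hP.posSemidef.kronecker hQ.posSemidef).1, by rw [← Matrix.mul_kronecker_mul, hP.2, hQ.2]⟩

theorem IsProjection.submatrix {P : Matrix X X ℂ} (hP : IsProjection P) (e : Y ≃ X) :
    IsProjection (P.submatrix e e) :=
  ⟨hP.1.submatrix e, by rw [Matrix.submatrix_mul_equiv, hP.2]⟩

theorem IsProjection.posSemidef_sandwich {P : Matrix X X ℂ} (hP : IsProjection P)
    {A : Matrix X X ℂ} (hA : A.PosSemidef) : (P * A * P).PosSemidef := by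
  have h := hA.conjTranspose_mul_mul_same P
  rwa [hP.1.eq] at h

theorem isTest_sandwich {P Q : Matrix X X ℂ} (hP : IsProjection P) (hQ : IsProjection Q) :
    IsTest (P * Q * P) := by
  refine ⟨hP.posSemidef_sandwich hQ.posSemidef, ?_⟩
  have h : 1 - P * Q * P = (1 - P) + P * (1 - Q) * P := by
    rw [Matrix.mul_sub, Matrix.sub_mul, Matrix.mul_one, hP.2]; abel
  rw [h]
  exact hP.one_sub.posSemidef.add (hP.posSemidef_sandwich hQ.one_sub.posSemidef)

/-- An operator union bound for projections that need not commute. The difference equals `(2 - P)(1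
- Q)(2 - P) + 2(1 - P)Q(1 - P)`, in which the cross terms `PQ + QP` cancel. -/
theorem one_sub_sandwich_le {P Q : Matrix X X ℂ} (hP : IsProjection P) (hQ : IsProjection Q) :
    ((2 : ℝ) • (1 - Q) + (3 : ℝ) • (1 - P) - (1 - P * Q * P)).PosSemidef := by
  have h1 : ((1 + 1 - P) * (1 - Q) * (1 + 1 - P)).PosSemidef := by
    have h2 : (1 + 1 - P).IsHermitian :=
      (Matrix.isHermitian_one.add Matrix.isHermitian_one).sub hP.1
    have h := hQ.one_sub.posSemidef.conjTranspose_mul_mul_same (1 + 1 - P)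
    rwa [h2.eq] at h
  have h3 := (hP.one_sub.posSemidef_sandwich hQ.posSemidef).smul (show (0 : ℝ) ≤ 2 by norm_num)
  have e2 : ∀ M : Matrix X X ℂ, (2 : ℝ) • M = M + M := fun M => two_smul ℝ M
  have e3 : ∀ M : Matrix X X ℂ, (3 : ℝ) • M = M + M + M := fun M => by module
  have key : (1 + 1 - P) * (1 - Q) * (1 + 1 - P) + ((1 - P) * Q * (1 - P) + (1 - P) * Q * (1 - P)) =
      (1 - Q + (1 - Q)) + (1 - P + (1 - P) + (1 - P)) - (1 - P * Q * P) + (P * P - P) := by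
    noncomm_ring
  have h := h1.add h3
  rw [e2, key, hP.2, sub_self, add_zero] at h
  rwa [e2, e3]

/-- Compressing by a projection does not increase the purity. -/
theorem trace_sandwich_mul_le {P η : Matrix X X ℂ} (hP : IsProjection P) (hη : η.PosSemidef) :
    (η * (P * η * P)).trace.re ≤ (η * η).trace.re := by
  have hle : ∀ {B : Matrix X X ℂ}, B.PosSemidef → (P * B).trace.re ≤ B.trace.re := by
    intro B hB
    have := trace_mul_re_le hP.one_sub.posSemidef hB
    rwa [Matrix.one_mul] at this
  have h1 : (η * (P * η * P)).trace = (P * (η * P * η)).trace := by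
    rw [← Matrix.mul_assoc, Matrix.trace_mul_comm]
    simp only [Matrix.mul_assoc]
  have h2 : (η * P * η).trace = (P * (η * η)).trace := by
    rw [Matrix.mul_assoc, Matrix.trace_mul_comm, Matrix.mul_assoc]
  rw [h1]
  have h3 : (η * P * η).PosSemidef := by
    have h := hP.posSemidef.conjTranspose_mul_mul_same η
    rwa [hη.1.eq] at h
  have h4 : (η * η).PosSemidef := by
    have h := Matrix.posSemidef_conjTranspose_mul_self η
    rwa [hη.1.eq] at h
  refine (hle h3).trans ?_
  rw [h2]
  exact hle h4

/-- The marginal of a bipartite operator on the second system. -/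
def margSnd {X Y : Type*} [Fintype X] (W : Matrix (X × Y) (X × Y) ℂ) : Matrix Y Y ℂ :=
  Matrix.of fun y y' => ∑ x, W (x, y) (x, y')

theorem posSemidef_margSnd {W : Matrix (X × Y) (X × Y) ℂ} (hW : W.PosSemidef) :
    (margSnd W).PosSemidef := by
  have : margSnd W = ∑ x, W.submatrix (fun y => (x, y)) (fun y => (x, y)) := by
    ext r r'
    simp [margSnd, Matrix.sum_apply]
  rw [this]
  exact Matrix.posSemidef_sum _ fun a _ => hW.submatrix _

theorem trace_kronecker_one_mul (A : Matrix X X ℂ) (W : Matrix (X × Y) (X × Y) ℂ) :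
    ((A ⊗ₖ (1 : Matrix Y Y ℂ)) * W).trace = (A * margFst W).trace := by
  simp only [Matrix.trace, Matrix.diag_apply, Matrix.mul_apply, Fintype.sum_prod_type,
    Matrix.kroneckerMap_apply, Matrix.one_apply, margFst, Matrix.of_apply, Finset.mul_sum]
  refine Finset.sum_congr rfl fun x _ => ?_
  rw [Finset.sum_comm]
  refine Finset.sum_congr rfl fun x' _ => Finset.sum_congr rfl fun y _ => ?_
  simp

theorem trace_one_kronecker_mul (B : Matrix Y Y ℂ) (W : Matrix (X × Y) (X × Y) ℂ) :
    (((1 : Matrix X X ℂ) ⊗ₖ B) * W).trace = (B * margSnd W).trace := by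
  simp only [Matrix.trace, Matrix.diag_apply, Matrix.mul_apply, Fintype.sum_prod_type,
    Matrix.kroneckerMap_apply, Matrix.one_apply, margSnd, Matrix.of_apply, Finset.mul_sum]
  rw [Finset.sum_comm]
  refine Finset.sum_congr rfl fun y _ => ?_
  rw [Finset.sum_comm (γ := X)]
  simp only [ite_mul, one_mul, zero_mul]
  rw [Finset.sum_comm]
  simp only [Finset.sum_ite_irrel, Finset.sum_const_zero, Finset.sum_ite_eq, Finset.mem_univ,
    if_true]
  exact Finset.sum_comm

theorem kronecker_le {A A' : Matrix X X ℂ} {B : Matrix Y Y ℂ} (hA : (A' - A).PosSemidef)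
    (hB : B.PosSemidef) : (A' ⊗ₖ B - A ⊗ₖ B).PosSemidef := by
  have h : A' ⊗ₖ B - A ⊗ₖ B = (A' - A) ⊗ₖ B := by
    ext x y
    simp [sub_mul]
  rw [h]
  exact hA.kronecker hB

/-- The source of the order-two entropy. The projections move onto the product state, `Q` is
replaced by `κ ω`, and `PθP` by `t • 1`; tracing out `X` then leaves `Tr[η P' η P']`, at most the
purity of `η`. Nothing is asked of `P'` beyond being a projection. -/
theorem trace_test_kronecker_le {Q ω : Matrix (X × Y) (X × Y) ℂ} {θ P : Matrix X X ℂ}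
    {P' : Matrix Y Y ℂ} {κ t : ℝ} (hω : ω.PosSemidef) (hθ : θ.PosSemidef) (hP : IsProjection P)
    (hP' : IsProjection P') (hκ : 0 ≤ κ) (ht : 0 ≤ t) (hQ : (κ • ω - Q).PosSemidef)
    (hflat : (t • 1 - P * θ * P).PosSemidef) :
    ((P ⊗ₖ P') * Q * (P ⊗ₖ P') * (θ ⊗ₖ margSnd ω)).trace.re ≤
      t * κ * (margSnd ω * margSnd ω).trace.re := by
  set η := margSnd ω with hηdef
  have hη : η.PosSemidef := posSemidef_margSnd hω
  have hY := hP'.posSemidef_sandwich hη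
  have hZ := (hP.posSemidef_sandwich hθ).kronecker hY
  have h1 : ((P ⊗ₖ P') * Q * (P ⊗ₖ P') * (θ ⊗ₖ η)).trace =
      (Q * ((P * θ * P) ⊗ₖ (P' * η * P'))).trace := by
    rw [Matrix.mul_kronecker_mul, Matrix.mul_kronecker_mul, Matrix.mul_assoc, Matrix.mul_assoc,
      Matrix.trace_mul_comm]
    simp only [Matrix.mul_assoc]
  have h2 := trace_mul_re_le hQ hZ
  have h3 := trace_mul_re_le (kronecker_le hflat hY) hω
  rw [Matrix.smul_kronecker, Matrix.smul_mul, Matrix.trace_smul, trace_one_kronecker_mul,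
    ← hηdef, Matrix.trace_mul_comm (P' * η * P'), Complex.smul_re, smul_eq_mul,
    Matrix.trace_mul_comm _ ω] at h3
  rw [Matrix.smul_mul, Matrix.trace_smul, Complex.smul_re, smul_eq_mul] at h2
  rw [h1]
  have h4 := trace_sandwich_mul_le hP' hη
  calc _ ≤ _ := h2
    _ ≤ κ * (t * (η * η).trace.re) := by gcongr; exact h3.trans (by gcongr)
    _ = _ := by ring

theorem trace_submatrix_equiv (e : Y ≃ X) (M : Matrix X X ℂ) :
    (M.submatrix e e).trace = M.trace := by
  simp only [Matrix.trace, Matrix.diag_apply, Matrix.submatrix_apply]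
  exact Equiv.sum_comp e fun x => M x x

theorem trace_test_le_of_equiv {Z : Type*} [Fintype Z] [DecidableEq Z] (e : X × Y ≃ Z)
    {Q ω W D : Matrix Z Z ℂ} {θ P : Matrix X X ℂ}
    {P' : Matrix Y Y ℂ} {κ t : ℝ} (hω : ω.PosSemidef) (hθ : θ.PosSemidef) (hP : IsProjection P)
    (hP' : IsProjection P') (hκ : 0 ≤ κ) (ht : 0 ≤ t) (hQ : (κ • ω - Q).PosSemidef)
    (hflat : (t • 1 - P * θ * P).PosSemidef) (hW : W.submatrix e e = P ⊗ₖ P')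
    (hD : D.submatrix e e = θ ⊗ₖ margSnd (ω.submatrix e e)) :
    (W * Q * W * D).trace.re ≤
      t * κ * (margSnd (ω.submatrix e e) * margSnd (ω.submatrix e e)).trace.re := by
  have h := trace_test_kronecker_le (hω.submatrix e) hθ hP hP' hκ ht
    (Q := Q.submatrix e e) (hQ.submatrix e) hflat
  rwa [← hD, ← hW, Matrix.submatrix_mul_equiv, Matrix.submatrix_mul_equiv,
    Matrix.submatrix_mul_equiv, trace_submatrix_equiv] at h

end Projections

/-! ### Additivity of entropy on product states -/

section Entropy

variable {X Y : Type*} [Fintype X] [DecidableEq X] [Fintype Y] [DecidableEq Y]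

theorem entropy_conj_diagonal {U : Matrix X X ℂ} (hU : U.conjTranspose * U = 1) (p : X → ℝ) :
    entropy (U * Matrix.diagonal (fun a => (p a : ℂ)) * U.conjTranspose) = shannon p := by
  have hH := isHermitian_conj U p
  rw [entropy, hH.cfc_eq, Matrix.IsHermitian.cfc, Unitary.conjStarAlgAut_apply,
    Matrix.trace_mul_comm, ← Matrix.mul_assoc, Unitary.coe_star_mul_self, Matrix.one_mul,
    Matrix.trace_diagonal]
  -- The eigenvalues chosen by the spectral theorem and the given `p` are roots of the same
  -- characteristic polynomial, hence equal as multisets, which is all that entropy sees.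
  have h1 := hH.roots_charpoly_eq_eigenvalues
  rw [Matrix.charpoly_mul_comm, ← Matrix.mul_assoc, hU, Matrix.one_mul, Matrix.charpoly_diagonal,
    show (∏ i, (Polynomial.X - Polynomial.C (p i : ℂ))) =
      ((Finset.univ.val.map fun i => (p i : ℂ)).map fun z => Polynomial.X - Polynomial.C z).prod by
      rw [Multiset.map_map]; rfl, Polynomial.roots_multiset_prod_X_sub_C] at h1
  have h2 := congrArg (fun s : Multiset ℂ =>
    (s.map fun z => -(z.re * Real.logb 2 z.re)).sum) h1
  simp only [Multiset.map_map, Function.comp_def] at h2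
  have h3 : ∑ i, -(p i * Real.logb 2 (p i)) =
      ∑ i, -(hH.eigenvalues i * Real.logb 2 (hH.eigenvalues i)) := h2
  rw [shannon, h3]
  simp

theorem shannon_prod {p : X → ℝ} {q : Y → ℝ} (hp1 : ∑ a, p a = 1) (hq1 : ∑ b, q b = 1) :
    shannon (fun x : X × Y => p x.1 * q x.2) = shannon p + shannon q := by
  have h : ∀ a b, -(p a * q b * Real.logb 2 (p a * q b)) =
      -(p a * Real.logb 2 (p a)) * q b + p a * -(q b * Real.logb 2 (q b)) := by
    intro a b
    by_cases ha : p a = 0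
    · simp [ha]
    by_cases hb : q b = 0
    · simp [hb]
    rw [Real.logb_mul ha hb]
    ring
  simp only [shannon, Fintype.sum_prod_type, h, Finset.sum_add_distrib, ← Finset.mul_sum,
    ← Finset.sum_mul, hp1, hq1, mul_one, one_mul]

theorem entropy_kronecker {ρ : Matrix X X ℂ} {σ : Matrix Y Y ℂ} (hρ : IsState ρ)
    (hσ : IsState σ) : entropy (ρ ⊗ₖ σ) = entropy ρ + entropy σ := by
  obtain ⟨U, p, hU, -, hρU, -, hp1, hentp⟩ := exists_diagonalization hρ
  obtain ⟨V, q, hV, -, hσV, -, hq1, hentq⟩ := exists_diagonalization hσ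
  have h : ρ ⊗ₖ σ = (U ⊗ₖ V) * Matrix.diagonal
      (fun x : X × Y => ((p x.1 * q x.2 : ℝ) : ℂ)) * (U ⊗ₖ V).conjTranspose := by
    rw [hρU, hσV, Matrix.mul_kronecker_mul, Matrix.mul_kronecker_mul,
      Matrix.diagonal_kronecker_diagonal, Matrix.conjTranspose_kronecker]
    simp
  rw [h, entropy_conj_diagonal, shannon_prod hp1 hq1, hentp, hentq]
  rw [Matrix.conjTranspose_kronecker, ← Matrix.mul_kronecker_mul, hU, hV, Matrix.one_kronecker_one]

end Entropy

/-! ### The asymptotic coding theorem -/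

section Powers

variable {A B C R S : Type*}

/-- Regroup `n` copies of `RSC` into `RⁿSⁿCⁿ`. -/
def regroup (n : ℕ) (R S C : Type*) :
    ((Fin n → R) × (Fin n → S)) × (Fin n → C) ≃ (Fin n → (R × S) × C) where
  toFun x t := ((x.1.1 t, x.1.2 t), x.2 t)
  invFun f := ((fun t => (f t).1.1, fun t => (f t).1.2), fun t => (f t).2)
  left_inv _ := rfl
  right_inv _ := rfl

/-- The operator `ω^{⊗n}` on `RⁿSⁿCⁿ`. -/
def blockPow (n : ℕ) (ω : Matrix ((R × S) × C) ((R × S) × C) ℂ) :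
    Matrix (((Fin n → R) × (Fin n → S)) × (Fin n → C))
      (((Fin n → R) × (Fin n → S)) × (Fin n → C)) ℂ :=
  (tensorPow n ω).submatrix (regroup n R S C) (regroup n R S C)

theorem macOut_macPow [Fintype A] [Fintype B] [DecidableEq A] [DecidableEq B]
    (N : Matrix (A × B) (A × B) ℂ →ₗ[ℂ] Matrix C C ℂ)
    (θ : Matrix (R × A) (R × A) ℂ) (γ : Matrix (S × B) (S × B) ℂ) (n : ℕ) :
    macOut (macPow N n) (copies (Fin n) θ) (copies (Fin n) γ) = blockPow n (macOut N θ γ) := by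
  -- Expanding each copy of `N` in matrix units turns the tensor power into a product of sums, whose
  -- expansion is the definition of `macPow` up to regrouping indices.
  have hN : ∀ (Z : Matrix (A × B) (A × B) ℂ) (c c' : C), N Z c c' =
      ∑ i : A × B, ∑ j : A × B, Z i j * N (Matrix.single i j 1) c c' := by
    intro Z c c'
    conv_lhs => rw [Matrix.matrix_eq_sum_single Z]
    simp only [map_sum, Matrix.sum_apply]
    refine Finset.sum_congr rfl fun i _ => Finset.sum_congr rfl fun j _ => ?_
    have : Matrix.single i j (Z i j) = Z i j • Matrix.single i j (1 : ℂ) := by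
      rw [Matrix.smul_single, smul_eq_mul, mul_one]
    rw [this, map_smul, Matrix.smul_apply, smul_eq_mul]
  ext ⟨⟨r, s⟩, c⟩ ⟨⟨r', s'⟩, c'⟩
  let F : Fin n → A × B → A × B → ℂ := fun t i j =>
    θ (r t, i.1) (r' t, j.1) * γ (s t, i.2) (s' t, j.2) *
      N (Matrix.single i j 1) (c t) (c' t)
  let e := Equiv.arrowProdEquivProdArrow (Fin n) (fun _ => A) (fun _ => B)
  have h1 : blockPow n (macOut N θ γ) ((r, s), c) ((r', s'), c') =
      ∏ t, ∑ i : A × B, ∑ j : A × B, F t i j := by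
    change ∏ t, N _ (c t) (c' t) = _
    refine Finset.prod_congr rfl fun t _ => ?_
    rw [hN]
    rfl
  rw [h1, Fintype.prod_sum]
  simp_rw [Fintype.prod_sum]
  change ∑ i, ∑ j, _ = _
  rw [← Equiv.sum_comp e]
  refine Finset.sum_congr rfl fun i _ => ?_
  rw [← Equiv.sum_comp e]
  refine Finset.sum_congr rfl fun j _ => ?_
  simp only [F, Finset.prod_mul_distrib]
  rfl

theorem margFst_copies [Fintype A] (θ : Matrix (R × A) (R × A) ℂ) (n : ℕ) :
    margFst (copies (Fin n) θ) = tensorPow n (margFst θ) := by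
  ext r r'
  exact sum_prod_eq fun (t : Fin n) a => θ (r t, a) (r' t, a)

theorem sum_sum_prod_eq {ι X Y : Type*} [Fintype ι] [DecidableEq ι] [Fintype X] [Fintype Y]
    (f : ι → X → Y → ℂ) :
    ∑ x : ι → X, ∑ y : ι → Y, ∏ i, f i (x i) (y i) = ∏ i, ∑ u, ∑ v, f i u v := by
  have h : ∀ x : ι → X, ∑ y : ι → Y, ∏ i, f i (x i) (y i) = ∏ i, ∑ v, f i (x i) v :=
    fun x => sum_prod_eq fun i v => f i (x i) v
  simp_rw [h]
  exact sum_prod_eq fun i u => ∑ v, f i u v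

variable [Fintype R] [Fintype S] [Fintype C] (ω : Matrix ((R × S) × C) ((R × S) × C) ℂ) (n : ℕ)

theorem margR_blockPow : margR (blockPow n ω) = tensorPow n (margR ω) := by
  ext r r'
  exact sum_sum_prod_eq fun (t : Fin n) s c => ω ((r t, s), c) ((r' t, s), c)

theorem margS_blockPow : margS (blockPow n ω) = tensorPow n (margS ω) := by
  ext s s'
  exact sum_sum_prod_eq fun (t : Fin n) r c => ω ((r, s t), c) ((r, s' t), c)

theorem margC_blockPow : margC (blockPow n ω) = tensorPow n (margC ω) := by
  ext c c'
  exact sum_sum_prod_eq fun (t : Fin n) r s => ω ((r, s), c t) ((r, s), c' t)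

theorem trace_mul_self_tensorPow {X : Type*} [Fintype X] (ρ : Matrix X X ℂ) :
    (tensorPow n ρ * tensorPow n ρ).trace = (ρ * ρ).trace ^ n := by
  rw [← tensorPow_mul, trace_tensorPow]

theorem purity_margSC_blockPow : (margSC (blockPow n ω) * margSC (blockPow n ω)).trace =
    (margSC ω * margSC ω).trace ^ n := by
  let e : (Fin n → S) × (Fin n → C) ≃ (Fin n → S × C) :=
    (Equiv.arrowProdEquivProdArrow (Fin n) (fun _ => S) (fun _ => C)).symm
  have h : margSC (blockPow n ω) = (tensorPow n (margSC ω)).submatrix e e := by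
    ext x y
    exact sum_prod_eq fun (t : Fin n) r => ω ((r, x.1 t), x.2 t) ((r, y.1 t), y.2 t)
  classical
  rw [h, Matrix.submatrix_mul_equiv, trace_submatrix_equiv, trace_mul_self_tensorPow]

theorem purity_margRC_blockPow : (margRC (blockPow n ω) * margRC (blockPow n ω)).trace =
    (margRC ω * margRC ω).trace ^ n := by
  let e : (Fin n → R) × (Fin n → C) ≃ (Fin n → R × C) :=
    (Equiv.arrowProdEquivProdArrow (Fin n) (fun _ => R) (fun _ => C)).symm
  have h : margRC (blockPow n ω) = (tensorPow n (margRC ω)).submatrix e e := by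
    ext x y
    exact sum_prod_eq fun (t : Fin n) s => ω ((x.1 t, s), x.2 t) ((y.1 t, s), y.2 t)
  classical
  rw [h, Matrix.submatrix_mul_equiv, trace_submatrix_equiv, trace_mul_self_tensorPow]

theorem purity_margC_blockPow : (margC (blockPow n ω) * margC (blockPow n ω)).trace =
    (margC ω * margC ω).trace ^ n := by
  rw [margC_blockPow, trace_mul_self_tensorPow]

variable {ω} in
theorem IsState.blockPow (hω : IsState ω) : IsState (blockPow n ω) := by
  classical
  exact ⟨(hω.tensorPow (n := n)).1.submatrix _,
    (trace_submatrix_equiv _ _).trans (hω.tensorPow (n := n)).2⟩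

end Powers

/-! ### The sandwiched test against the three decoupled states -/

section Test

variable {R S C : Type*} [Fintype R] [Fintype S] [Fintype C]
  [DecidableEq R] [DecidableEq S] [DecidableEq C]

/-- The projection `P_R ⊗ P_S ⊗ I_C`. -/
def pairProj (C : Type*) [DecidableEq C] (P : Matrix R R ℂ) (P' : Matrix S S ℂ) :
    Matrix ((R × S) × C) ((R × S) × C) ℂ :=
  (P ⊗ₖ P') ⊗ₖ (1 : Matrix C C ℂ)

theorem isProjection_pairProj {P : Matrix R R ℂ} {P' : Matrix S S ℂ} (hP : IsProjection P)
    (hP' : IsProjection P') : IsProjection (pairProj C P P') :=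
  (hP.kronecker hP').kronecker IsProjection.one

theorem trace_one_sub_pairProj_mul_le {P : Matrix R R ℂ} {P' : Matrix S S ℂ} (hP : IsProjection P)
    (hP' : IsProjection P') {ω : Matrix ((R × S) × C) ((R × S) × C) ℂ} (hω : ω.PosSemidef) :
    ((1 - pairProj C P P') * ω).trace.re ≤
      ((1 - P) * margR ω).trace.re + ((1 - P') * margS ω).trace.re := by
  -- Union bound for commuting projections: the slack is `(1 - P) ⊗ (1 - P') ⊗ 1`.
  have h1 : (((1 - P) ⊗ₖ (1 : Matrix S S ℂ) + (1 : Matrix R R ℂ) ⊗ₖ (1 - P')) ⊗ₖ (1 : Matrix C C ℂ)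
      - (1 - pairProj C P P')).PosSemidef := by
    have h := (hP.one_sub.kronecker hP'.one_sub).kronecker (IsProjection.one (X := C))
    convert h.posSemidef using 1
    ext x y
    simp only [pairProj, Matrix.sub_apply, Matrix.add_apply, Matrix.kroneckerMap_apply]
    have : (1 : Matrix ((R × S) × C) ((R × S) × C) ℂ) x y =
        (1 : Matrix R R ℂ) x.1.1 y.1.1 * (1 : Matrix S S ℂ) x.1.2 y.1.2 *
          (1 : Matrix C C ℂ) x.2 y.2 := by
      rw [← Matrix.one_kronecker_one, ← Matrix.one_kronecker_one]
      rfl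
    rw [this]
    ring
  refine (trace_mul_re_le h1 hω).trans (le_of_eq ?_)
  rw [trace_kronecker_one_mul, Matrix.add_mul, Matrix.trace_add, trace_kronecker_one_mul,
    trace_one_kronecker_mul, Complex.add_re]
  rfl

variable {θ : Matrix R R ℂ} {γ : Matrix S S ℂ} {ω Q : Matrix ((R × S) × C) ((R × S) × C) ℂ}
  {P : Matrix R R ℂ} {P' : Matrix S S ℂ} {κ t t' : ℝ}

theorem trace_test_decoupleR_le (hω : ω.PosSemidef) (hθ : θ.PosSemidef) (hP : IsProjection P)
    (hP' : IsProjection P') (hκ : 0 ≤ κ) (ht : 0 ≤ t) (hQ : (κ • ω - Q).PosSemidef)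
    (hflat : (t • 1 - P * θ * P).PosSemidef) :
    (pairProj C P P' * Q * pairProj C P P' * decoupleR θ ω).trace.re ≤
      t * κ * (margSC ω * margSC ω).trace.re := by
  -- In the splitting `R` versus `SC`, the second projection is `P' ⊗ 1`; flatness of `P'` plays no
  -- role.
  refine trace_test_le_of_equiv (Equiv.prodAssoc R S C).symm hω hθ hP
    (hP'.kronecker (IsProjection.one (X := C))) hκ ht hQ hflat ?_ rfl
  ext x y
  simp [pairProj, mul_assoc]

theorem trace_test_decoupleS_le (hω : ω.PosSemidef) (hγ : γ.PosSemidef) (hP : IsProjection P)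
    (hP' : IsProjection P') (hκ : 0 ≤ κ) (ht : 0 ≤ t) (hQ : (κ • ω - Q).PosSemidef)
    (hflat : (t • 1 - P' * γ * P').PosSemidef) :
    (pairProj C P P' * Q * pairProj C P P' * decoupleS γ ω).trace.re ≤
      t * κ * (margRC ω * margRC ω).trace.re := by
  let e : S × (R × C) ≃ (R × S) × C :=
    ⟨fun x => ((x.2.1, x.1), x.2.2), fun x => (x.1.2, (x.1.1, x.2)), fun _ => rfl, fun _ => rfl⟩
  refine trace_test_le_of_equiv e hω hγ hP'
    (hP.kronecker (IsProjection.one (X := C))) hκ ht hQ hflat ?_ rfl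
  ext x y
  simp only [e, pairProj, Equiv.coe_fn_mk, Matrix.submatrix_apply, Matrix.kroneckerMap_apply]
  ring

theorem trace_test_decoupleRS_le (hω : ω.PosSemidef) (hθ : θ.PosSemidef) (hγ : γ.PosSemidef)
    (hP : IsProjection P) (hP' : IsProjection P') (hκ : 0 ≤ κ) (ht : 0 ≤ t) (ht' : 0 ≤ t')
    (hQ : (κ • ω - Q).PosSemidef) (hflat : (t • 1 - P * θ * P).PosSemidef)
    (hflat' : (t' • 1 - P' * γ * P').PosSemidef) :
    (pairProj C P P' * Q * pairProj C P P' * decoupleRS θ γ ω).trace.re ≤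
      t * t' * κ * (margC ω * margC ω).trace.re := by
  have hflat2 : ((t * t') • 1 - (P ⊗ₖ P') * (θ ⊗ₖ γ) * (P ⊗ₖ P')).PosSemidef := by
    rw [← Matrix.mul_kronecker_mul, ← Matrix.mul_kronecker_mul]
    have h1 := kronecker_le hflat (hP'.posSemidef_sandwich hγ)
    have h2 := (Matrix.PosSemidef.one (n := R) (R := ℂ)).smul ht |>.kronecker hflat'
    convert h1.add h2 using 1
    ext x y
    simp only [Matrix.sub_apply, Matrix.add_apply, Matrix.kroneckerMap_apply, Matrix.smul_apply]
    have : (1 : Matrix (R × S) (R × S) ℂ) x y =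
        (1 : Matrix R R ℂ) x.1 y.1 * (1 : Matrix S S ℂ) x.2 y.2 := by
      rw [← Matrix.one_kronecker_one]
      rfl
    rw [this]
    simp only [Complex.real_smul, Complex.ofReal_mul]
    ring
  have hC : margC ω = margSnd ω := by
    ext c c'
    simp [margC, margSnd, Fintype.sum_prod_type]
  have h := trace_test_le_of_equiv (D := decoupleRS θ γ ω) (W := pairProj C P P')
    (Equiv.refl ((R × S) × C)) hω (hθ.kronecker hγ)
    (hP.kronecker hP') (IsProjection.one (X := C)) hκ (mul_nonneg ht ht') hQ hflat2 rfl
    (by rw [decoupleRS, hC]; rfl)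
  rw [hC]
  exact h

end Test

/-! ### Message counts and exponents -/

section Rates

/-- The number of wrong messages, one less than the total, absorbs the rounding up, so negative
rates need no separate treatment. -/
theorem natCeil_rpow_sub_one_le (a : ℝ) (n : ℕ) :
    (⌈(2 : ℝ) ^ ((n : ℝ) * a)⌉₊ : ℝ) - 1 ≤ ((2 : ℝ) ^ a) ^ n := by
  have h := Nat.ceil_lt_add_one (Real.rpow_nonneg (two_pos (α := ℝ)).le ((n : ℝ) * a))
  rw [← Real.rpow_natCast, ← Real.rpow_mul two_pos.le, mul_comm a]
  linarith

theorem rate_mul_lt_one {a x t u : ℝ} (hu : 0 ≤ u) (h : a - x + t < -Real.logb 2 u) :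
    (2 : ℝ) ^ a * (((2 : ℝ) ^ x)⁻¹ * 2 ^ t * u) < 1 := by
  -- For `u = 0` the convention `Real.logb 2 0 = 0` makes the hypothesis meaningless, but the
  -- product is zero.
  rcases hu.eq_or_lt with rfl | hu
  · simp
  · have h1 : (2 : ℝ) ^ Real.logb 2 u = u := Real.rpow_logb two_pos (by norm_num) hu
    have h2 : (2 : ℝ) ^ a * (((2 : ℝ) ^ x)⁻¹ * 2 ^ t * u) = 2 ^ (a - x + t + Real.logb 2 u) := by
      rw [Real.rpow_add two_pos, Real.rpow_add two_pos, Real.rpow_sub two_pos, h1]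
      ring
    rw [h2]
    exact Real.rpow_lt_one_of_one_lt_of_neg one_lt_two (by linarith)

theorem purity_nonneg {X : Type*} [Fintype X] {ρ : Matrix X X ℂ} (hρ : ρ.PosSemidef) :
    0 ≤ (ρ * ρ).trace.re := trace_mul_re_nonneg hρ hρ

theorem re_purity_pow {X : Type*} [Fintype X] {ρ : Matrix X X ℂ} (hρ : ρ.PosSemidef) (n : ℕ) :
    ((ρ * ρ).trace ^ n).re = (ρ * ρ).trace.re ^ n := by
  have h := Matrix.posSemidef_conjTranspose_mul_self ρ
  rw [hρ.1.eq] at h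
  have h1 := (Complex.le_def.mp h.trace_nonneg).2
  have h2 : (ρ * ρ).trace = ((ρ * ρ).trace.re : ℂ) := Complex.ext rfl (by simpa using h1.symm)
  rw [h2, ← Complex.ofReal_pow, Complex.ofReal_re, Complex.ofReal_re]

end Rates

section Marginals

variable {R S C : Type*} [Fintype R] [Fintype S] [Fintype C]
  {ω : Matrix ((R × S) × C) ((R × S) × C) ℂ}

theorem posSemidef_margSC (hω : ω.PosSemidef) : (margSC ω).PosSemidef := by
  have : margSC ω = ∑ r, ω.submatrix (fun x : S × C => ((r, x.1), x.2))
      (fun x => ((r, x.1), x.2)) := by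
    ext x y
    simp [margSC, Matrix.sum_apply]
  rw [this]
  exact Matrix.posSemidef_sum _ fun r _ => hω.submatrix _

theorem posSemidef_margRC (hω : ω.PosSemidef) : (margRC ω).PosSemidef := by
  have : margRC ω = ∑ s, ω.submatrix (fun x : R × C => ((x.1, s), x.2))
      (fun x => ((x.1, s), x.2)) := by
    ext x y
    simp [margRC, Matrix.sum_apply]
  rw [this]
  exact Matrix.posSemidef_sum _ fun r _ => hω.submatrix _

theorem posSemidef_margC (hω : ω.PosSemidef) : (margC ω).PosSemidef := by
  have : margC ω = ∑ r, ∑ s, ω.submatrix (fun c : C => ((r, s), c))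
      (fun c => ((r, s), c)) := by
    ext x y
    simp [margC, Matrix.sum_apply]
  rw [this]
  exact Matrix.posSemidef_sum _ fun r _ => Matrix.posSemidef_sum _ fun s _ => hω.submatrix _

end Marginals

/-- A family of tests with exponentially small errors. -/
theorem exists_test {R S C : Type*} [Fintype R] [Fintype S] [Fintype C]
    [DecidableEq R] [DecidableEq S] [DecidableEq C]
    {ω : Matrix ((R × S) × C) ((R × S) × C) ℂ} (hω : IsState ω)
    {θ : Matrix R R ℂ} (hθ : IsState θ) {γ : Matrix S S ℂ} (hγ : IsState γ)
    (hR : margR ω = θ) (hS : margS ω = γ) {t x y : ℝ} (ht : entropy ω < t)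
    (hx : x < entropy θ) (hy : y < entropy γ) :
    ∃ q₁ q₂ q₃ : ℝ, (0 ≤ q₁ ∧ q₁ < 1) ∧ (0 ≤ q₂ ∧ q₂ < 1) ∧ (0 ≤ q₃ ∧ q₃ < 1) ∧
      ∀ n : ℕ, ∃ T, IsTest T ∧
        ((1 - T) * blockPow n ω).trace.re ≤ 2 * q₁ ^ n + 3 * (q₂ ^ n + q₃ ^ n) ∧
        (T * decoupleR (tensorPow n θ) (blockPow n ω)).trace.re ≤
          (((2 : ℝ) ^ x)⁻¹ * 2 ^ t * (margSC ω * margSC ω).trace.re) ^ n ∧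
        (T * decoupleS (tensorPow n γ) (blockPow n ω)).trace.re ≤
          (((2 : ℝ) ^ y)⁻¹ * 2 ^ t * (margRC ω * margRC ω).trace.re) ^ n ∧
        (T * decoupleRS (tensorPow n θ) (tensorPow n γ) (blockPow n ω)).trace.re ≤
          (((2 : ℝ) ^ (x + y))⁻¹ * 2 ^ t * (margC ω * margC ω).trace.re) ^ n := by
  obtain ⟨q₁, h10, h11, hq₁⟩ := exists_dominated_projection hω ht
  obtain ⟨q₂, h20, h21, hq₂⟩ := exists_flattening_projection hθ hx
  obtain ⟨q₃, h30, h31, hq₃⟩ := exists_flattening_projection hγ hy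
  refine ⟨q₁, q₂, q₃, ⟨h10, h11⟩, ⟨h20, h21⟩, ⟨h30, h31⟩, fun n => ?_⟩
  obtain ⟨Q₀, hQ₀, hQdom₀, hQerr₀⟩ := hq₁ n
  obtain ⟨P, hP, hPflat, hPerr⟩ := hq₂ n
  obtain ⟨P', hP', hP'flat, hP'err⟩ := hq₃ n
  have hωn := (hω.blockPow n).1
  have hθn := (hθ.tensorPow (n := n)).1
  have hγn := (hγ.tensorPow (n := n)).1
  let e := regroup n R S C
  set Q := Q₀.submatrix e e with hQdef
  have hQ : IsProjection Q := hQ₀.submatrix e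
  have hQdom : (((2 : ℝ) ^ t) ^ n • blockPow n ω - Q).PosSemidef := hQdom₀.submatrix e
  have hQerr : ((1 - Q) * blockPow n ω).trace.re ≤ q₁ ^ n := by
    have h1 : 1 - Q = (1 - Q₀).submatrix e e := by
      rw [hQdef, ← Matrix.submatrix_one_equiv e]
      rfl
    rw [h1, blockPow, Matrix.submatrix_mul_equiv, trace_submatrix_equiv]
    exact hQerr₀
  have hW : IsProjection (pairProj (Fin n → C) P P') := isProjection_pairProj hP hP'
  have hc : ∀ z : ℝ, (0 : ℝ) ≤ ((2 : ℝ) ^ z) ^ n := fun z => by positivity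
  have hc' : ∀ z : ℝ, (0 : ℝ) ≤ (((2 : ℝ) ^ z) ^ n)⁻¹ := fun z => by positivity
  refine ⟨pairProj (Fin n → C) P P' * Q * pairProj (Fin n → C) P P', isTest_sandwich hW hQ,
    ?_, ?_, ?_, ?_⟩
  · refine (trace_mul_re_le (one_sub_sandwich_le hW hQ) hωn).trans ?_
    have h1 := trace_one_sub_pairProj_mul_le hP hP' hωn
    rw [margR_blockPow, margS_blockPow, hR, hS] at h1
    rw [Matrix.add_mul, Matrix.trace_add, Matrix.smul_mul, Matrix.smul_mul, Matrix.trace_smul,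
      Matrix.trace_smul, Complex.add_re, Complex.smul_re, Complex.smul_re, smul_eq_mul, smul_eq_mul]
    linarith
  · have h := trace_test_decoupleR_le hωn hθn hP hP' (hc t) (hc' x) hQdom hPflat
    rwa [purity_margSC_blockPow, re_purity_pow (posSemidef_margSC hω.1), ← inv_pow, ← mul_pow,
      ← mul_pow] at h
  · have h := trace_test_decoupleS_le hωn hγn hP hP' (hc t) (hc' y) hQdom hP'flat
    rwa [purity_margRC_blockPow, re_purity_pow (posSemidef_margRC hω.1), ← inv_pow, ← mul_pow,
      ← mul_pow] at h
  · have h := trace_test_decoupleRS_le hωn hθn hγn hP hP' (hc t) (hc' x) (hc' y) hQdom hPflat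
      hP'flat
    rwa [purity_margC_blockPow, re_purity_pow (posSemidef_margC hω.1), ← inv_pow, ← inv_pow,
      ← mul_pow, ← mul_pow, ← mul_pow, ← mul_inv, ← Real.rpow_add two_pos] at h

end EAMAC

theorem mainTheorem3 {A B C R S : Type*}
    [Fintype A] [Fintype B] [Fintype C] [Fintype R] [Fintype S]
    [DecidableEq A] [DecidableEq B] [DecidableEq C] [DecidableEq R] [DecidableEq S]
    (N : Matrix (A × B) (A × B) ℂ →ₗ[ℂ] Matrix C C ℂ) (hN : EAMAC.IsChannel N)
    (θ : Matrix (R × A) (R × A) ℂ) (hθ : EAMAC.IsState θ)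
    (γ : Matrix (S × B) (S × B) ℂ) (hγ : EAMAC.IsState γ)
    (R₁ R₂ : ℝ)
    (h₁ : R₁ ≤ EAMAC.infoR_CS (EAMAC.macOut N θ γ))
    (h₂ : R₂ ≤ EAMAC.infoS_CR (EAMAC.macOut N θ γ))
    (h₁₂ : R₁ + R₂ ≤ EAMAC.infoRS_C (EAMAC.macOut N θ γ)) :
    EAMAC.AchievableBySimultaneousDecoding N θ γ R₁ R₂ := by
  intro ε hε _ δ hδ
  have hω := EAMAC.IsState.macOut hN hθ hγ
  have hR := EAMAC.margR_macOut hN θ hγ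
  have hS := EAMAC.margS_macOut hN hθ γ
  have hRS := EAMAC.margRS_macOut hN θ γ
  set ω := EAMAC.macOut N θ γ with hωdef
  -- Each typicality threshold gives up `δ/4`. A single-rate exponent then loses `δ/2` against a
  -- gain of `δ`, and the sum-rate exponent loses `3δ/4` against `2δ`, so all three stay strictly
  -- negative even when the rate bounds are equalities.
  obtain ⟨q₁, q₂, q₃, hq₁, hq₂, hq₃, hT⟩ := EAMAC.exists_test hω hθ.margFst hγ.margFst hR hS
    (t := EAMAC.entropy ω + δ / 4) (x := EAMAC.entropy (EAMAC.margFst θ) - δ / 4)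
    (y := EAMAC.entropy (EAMAC.margFst γ) - δ / 4)
    (by linarith) (by linarith) (by linarith)
  simp only [EAMAC.infoR_CS, EAMAC.infoS_CR, EAMAC.infoRS_C, EAMAC.condSCgivenR,
    EAMAC.condRCgivenS, EAMAC.condCgivenRS, hR, hS, hRS,
    EAMAC.entropy_kronecker hθ.margFst hγ.margFst, EAMAC.entropyTwo] at h₁ h₂ h₁₂
  set t := EAMAC.entropy ω + δ / 4 with htdef
  set x := EAMAC.entropy (EAMAC.margFst θ) - δ / 4 with hxdef
  set y := EAMAC.entropy (EAMAC.margFst γ) - δ / 4 with hydef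
  have hu₁ := EAMAC.purity_nonneg (EAMAC.posSemidef_margSC hω.1)
  have hu₂ := EAMAC.purity_nonneg (EAMAC.posSemidef_margRC hω.1)
  have hu₃ := EAMAC.purity_nonneg (EAMAC.posSemidef_margC hω.1)
  have hb₁ := EAMAC.rate_mul_lt_one (a := R₁ - δ) (x := x) (t := t) hu₁ (by linarith)
  have hb₂ := EAMAC.rate_mul_lt_one (a := R₂ - δ) (x := y) (t := t) hu₂ (by linarith)
  have hb₃ := EAMAC.rate_mul_lt_one (a := (R₁ - δ) + (R₂ - δ)) (x := x + y) (t := t) hu₃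
    (by linarith)
  generalize (EAMAC.margSC ω * EAMAC.margSC ω).trace.re = u₁ at *
  generalize (EAMAC.margRC ω * EAMAC.margRC ω).trace.re = u₂ at *
  generalize (EAMAC.margC ω * EAMAC.margC ω).trace.re = u₃ at *
  set b₁ := (2 : ℝ) ^ (R₁ - δ) * (((2 : ℝ) ^ x)⁻¹ * 2 ^ t * u₁) with hb₁def
  set b₂ := (2 : ℝ) ^ (R₂ - δ) * (((2 : ℝ) ^ y)⁻¹ * 2 ^ t * u₂) with hb₂def
  set b₃ := (2 : ℝ) ^ ((R₁ - δ) + (R₂ - δ)) * (((2 : ℝ) ^ (x + y))⁻¹ * 2 ^ t * u₃) with hb₃def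
  have lim : ∀ {q : ℝ}, 0 ≤ q → q < 1 → Tendsto (fun n : ℕ => q ^ n) atTop (nhds 0) :=
    fun h h' => tendsto_pow_atTop_nhds_zero_of_lt_one h h'
  have hlim : Tendsto (fun n : ℕ => 2 * (2 * q₁ ^ n + 3 * (q₂ ^ n + q₃ ^ n)) +
      4 * (b₁ ^ n + b₂ ^ n + b₃ ^ n)) atTop (nhds 0) := by
    have h := ((((lim hq₁.1 hq₁.2).const_mul 2).add
      (((lim hq₂.1 hq₂.2).add (lim hq₃.1 hq₃.2)).const_mul 3)).const_mul 2).add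
      ((((lim (by positivity) hb₁).add (lim (by positivity) hb₂)).add
        (lim (by positivity) hb₃)).const_mul 4)
    simpa using h
  filter_upwards [hlim.eventually (eventually_le_nhds hε)] with n hn
  intro L M hL hM
  have hLpos : 0 < L := by rw [hL]; exact Nat.ceil_pos.mpr (by positivity)
  have hMpos : 0 < M := by rw [hM]; exact Nat.ceil_pos.mpr (by positivity)
  have hL1 : (L : ℝ) - 1 ≤ ((2 : ℝ) ^ (R₁ - δ)) ^ n := by
    rw [hL]; exact EAMAC.natCeil_rpow_sub_one_le _ _
  have hM1 : (M : ℝ) - 1 ≤ ((2 : ℝ) ^ (R₂ - δ)) ^ n := by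
    rw [hM]; exact EAMAC.natCeil_rpow_sub_one_le _ _
  -- Nonnegative counts of wrong messages are needed to multiply the test bounds by them.
  have hL0 : (0 : ℝ) ≤ (L : ℝ) - 1 := sub_nonneg.mpr (by exact_mod_cast hLpos)
  have hM0 : (0 : ℝ) ≤ (M : ℝ) - 1 := sub_nonneg.mpr (by exact_mod_cast hMpos)
  obtain ⟨T, hTest, hT0, hT1, hT2, hT3⟩ := hT n
  have hblock := EAMAC.macOut_macPow N θ γ n
  have hstate : (EAMAC.macOut (EAMAC.macPow N n) (EAMAC.copies (Fin n) θ)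
      (EAMAC.copies (Fin n) γ)).PosSemidef := by
    rw [hblock]; exact (hω.blockPow n).1
  refine ⟨EAMAC.positionCode (EAMAC.macPow N n) hθ.copies hγ.copies hTest L M,
    EAMAC.isPositionBased_positionCode _ _ _ _ _ _, ?_⟩
  refine (EAMAC.avgError_positionCode_le (EAMAC.macPow N n) hθ.copies hγ.copies hTest hstate
    hLpos hMpos).trans (le_trans ?_ hn)
  rw [hblock, EAMAC.margFst_copies, EAMAC.margFst_copies, ← hωdef]
  have e1 : ((L : ℝ) - 1) * (T * EAMAC.decoupleR (EAMAC.tensorPow n (EAMAC.margFst θ))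
      (EAMAC.blockPow n ω)).trace.re ≤ b₁ ^ n := by
    rw [hb₁def, mul_pow]
    exact (mul_le_mul_of_nonneg_left hT1 hL0).trans
      (mul_le_mul_of_nonneg_right hL1 (by positivity))
  have e2 : ((M : ℝ) - 1) * (T * EAMAC.decoupleS (EAMAC.tensorPow n (EAMAC.margFst γ))
      (EAMAC.blockPow n ω)).trace.re ≤ b₂ ^ n := by
    rw [hb₂def, mul_pow]
    exact (mul_le_mul_of_nonneg_left hT2 hM0).trans
      (mul_le_mul_of_nonneg_right hM1 (by positivity))
  have e3 : ((L : ℝ) - 1) * ((M : ℝ) - 1) * (T * EAMAC.decoupleRS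
      (EAMAC.tensorPow n (EAMAC.margFst θ)) (EAMAC.tensorPow n (EAMAC.margFst γ))
      (EAMAC.blockPow n ω)).trace.re ≤ b₃ ^ n := by
    rw [hb₃def, mul_pow, Real.rpow_add two_pos, mul_pow]
    exact (mul_le_mul_of_nonneg_left hT3 (mul_nonneg hL0 hM0)).trans
      (mul_le_mul_of_nonneg_right (mul_le_mul hL1 hM1 hM0 (by positivity)) (by positivity))
  linarith
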